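/- Let $K$ be an algebraically closed field of characteristic $0$ and let $\ell$ be a finite dimensional Lie algebra over $K$ with basis $\{u\}$ and dual basis $\{u'\}$ of $\ell'=\mathrm{Hom}(\ell,K)$. Let $W=S^{\infty/2}\tilde\ell'\otimes\wedge^{\infty/2}\tilde\ell'$ be the vertex operator Weil algebra of $\ell$. That is, $S^{\infty/2}\tilde\ell'$ is the module over the Weyl algebra with generators $\beta_n^x,\gamma_n^{\xi}$ ($x\in\ell$, $\xi\in\ell'$, linear in $x$ and $\xi$, $n\in\mathbb Z$; only nonzero commutators $[\gamma_n^{\xi},\beta_m^{x}]=\xi(x)\,\delta_{n+m,0}$) induced from the trivial representation of the subalgebra generated by the annihilation operators $\beta_n^x$ ($n\ge 0$), $\gamma_n^{\xi}$ ($n\ge 1$); and $\wedge^{\infty/2}\tilde\ell'$ is the module over the Clifford algebra with generators $b_n^x,c_n^{\xi}$ (only nonzero anticommutators $c_n^{\xi}b_m^{x}+b_m^{x}c_n^{\xi}=\xi(x)\,\delta_{n+m,0}$) induced from the trivial representation of the subalgebra generated by the annihilation operators $b_n^x$ ($n\ge 0$), $c_n^{\xi}$ ($n\ge 1$). The remaining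 generators are the creation operators. Let $\mathbf 1$ be the vacuum. The superdegree (fermion number) is $-1$ on the $b$'s, $+1$ on the $c$'s, $0$ on the $\beta$'s, $\gamma$'s and $\mathbf 1$; $[\ ,\ ]$ is the supercommutator, and $:\ :$ is normal ordering (annihilation operators to the right, with the proper sign). Put $$b^x(z)=\sum_n b^x_nz^{-n-1},\quad \beta^x(z)=\sum_n\beta^x_nz^{-n-1},\quad c^{\xi}(z)=\sum_n c^{\xi}_nz^{-n},\quad \gamma^{\xi}(z)=\sum_n\gamma^{\xi}_nz^{-n},$$ $$h=\sum_{u,n}\gamma_{-n}^{u'}b_n^u,\qquad h(z)=\sum_u\gamma^{u'}(z)b^u(z),\qquad k(z)=\sum_u\beta^u(z)\tfrac{d}{dz}c^{u'}(z),$$ $$\omega(z)=-\sum_u:b^u(z)\tfrac{d}{dz}c^{u'}(z):-\sum_u:\beta^u(z)\tfrac{d}{dz}\gamma^{u'}(z):\ =\sum_nL_nz^{-n-2},\qquad F(z)=\sum_u:c^{u'}(z)b^u(z):\,,$$ $$\mathbf h=\sum_u\gamma^{u'}_0b^u_{-1}\mathbf 1,\quad \mathbf k=\sum_u\beta^u_{-1}c^{u'}_{-1}\mathbf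 1,\quad \boldsymbol\omega=-\sum_ub^u_{-1}c^{u'}_{-1}\mathbf 1-\sum_u\beta^u_{-1}\gamma^{u'}_{-1}\mathbf 1 .$$ A field $a(z)$ corresponds to the state $\mathbf a$ if $a(z)\mathbf 1$ has no negative powers of $z$ and constant term $\mathbf a$; it has weight $w$ if $L_0\mathbf a=w\mathbf a$, and is primary of weight $w$ if moreover $L_n\mathbf a=0$ for all $n>0$. The charge of $a(z)$ is its coefficient at $z^{-1}$. (1) $[h,k(z)]=-\omega(z)$. Moreover $h(z),k(z),\omega(z)$ correspond to $\mathbf h,\mathbf k,\boldsymbol\omega$, the charge of $h(z)$ is $h$, $h^2=0$ and $h\,\mathbf k=-\boldsymbol\omega$. (2) Suppose that $\ell$ is semisimple, and let $\phi:\ell\to\ell'$ be the isomorphism given by a nonzero multiple of the Killing form. Put $$r=\sum_{u,n}n\,\gamma_{-n}^{\phi(u)}c_n^{u'},\qquad r(z)=\sum_u\gamma^{\phi(u)}(z)\tfrac{d}{dz}c^{u'}(z),\qquad t(z)=\sum_u\beta^{\phi^{-1}(u')}(z)b^u(z),$$ $$\mathbf r=\sum_u\gamma_0^{\phi(u)}c_{-1}^{u'}\mathbf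 1,\qquad \mathbf t=\sum_u\beta_{-1}^{\phi^{-1}(u')}b_{-1}^u\mathbf 1 .$$ Then $[r,t(z)]=-\omega(z)$. Moreover $r(z),t(z)$ correspond to $\mathbf r,\mathbf t$, the charge of $r(z)$ is $-r$, $r^2=0$ and $r\,\mathbf t=-\boldsymbol\omega$. (3) Consequently $h$ and, for semisimple $\ell$, $r$ give reductions of topological chiral algebra type. Let $(D,J,G,\sigma)$ be $(h,\,h(z),\,-k(z),\,-1)$ or $(r,\,-r(z),\,-t(z),\,1)$. Then $F(z)$ is of weight one and fermion number $0$, and its charge acts as multiplication by $j$ on the subspace of superdegree $j$; $J(z)$ is primary of weight one and fermion number $\sigma$, with charge $D$ and $D^2=0$; $G(z)$ is primary of weight two and fermion number $-\sigma$; and $[D,G(z)]=\omega(z)$. The Virasoro element is $D$-closed and $D$-exact, $D\boldsymbol\omega=0$ and $\boldsymbol\omega\in \mathrm{Im}\,D$, and every $L_n$ maps $\mathrm{Ker}\,D$ into $\mathrm{Im}\,D$, that is, the Virasoro algebra acts trivially on the cohomology of $D$. -/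

import Mathlib

open Module TensorProduct

noncomputable section

namespace VOWA

/-! ### Generalities on fields

A field on `V` is Mathlib's `VertexOperator K V`: a formal series `a(z) = ∑ aₖ zᵏ` with
coefficients in `End V` such that `a(z) v` is a Laurent series for every `v`.
`HVertexOperator.coeff a k` is the coefficient of `zᵏ`, and `VertexOperator.ncoeff a n` is the
mode `aₙ`, the coefficient of `z⁻ⁿ⁻¹`. -/

section Fields

variable {K V : Type*} [CommRing K] [AddCommGroup V] [Module K V]

/-- The endomorphism `∑ₙ fₙ` for a family of endomorphisms that is finite on every vector. -/
def locSum (f : ℤ → End K V) (hf : ∀ v, (Function.support fun n => f n v).Finite) :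
    End K V where
  toFun v := ∑ᶠ n, f n v
  map_add' v w := by
    rw [← finsum_add_distrib (hf v) (hf w)]
    simp
  map_smul' c v := by
    rw [RingHom.id_apply, smul_finsum' c (hf v)]
    simp

theorem exists_coeff_eq_zero (a : VertexOperator K V) (v : V) :
    ∃ N : ℤ, ∀ k < N, HVertexOperator.coeff a k v = 0 :=
  ⟨_, fun k hk => VertexOperator.coeff_eq_zero_of_lt_order a k v hk⟩

/-- The field `∑ₖ fₖ zᵏ`, for coefficients with `fₖ v = 0` for all `k` below a bound that depends
on `v`. -/
def mkField (f : ℤ → End K V) (hf : ∀ v, ∃ N : ℤ, ∀ k < N, f k v = 0) : VertexOperator K V :=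
  VertexOperator.of_coeff f fun v => by
    obtain ⟨N, hN⟩ := hf v
    refine ⟨N, fun k hk => ?_⟩
    by_contra h
    exact hk (hN k (not_le.mp h))

/-- The formal derivative `d/dz a(z)`. -/
def derivField (a : VertexOperator K V) : VertexOperator K V :=
  mkField (fun k => (k + 1) • HVertexOperator.coeff a (k + 1)) fun v => by
    obtain ⟨N, hN⟩ := exists_coeff_eq_zero a v
    refine ⟨N - 1, fun k hk => ?_⟩
    have : HVertexOperator.coeff a (k + 1) v = 0 := hN _ (by omega)
    rw [LinearMap.smul_apply, this, smul_zero]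

/-- The `i`-th term of the coefficient of `zᵏ` in the normally ordered product. The nonnegative
powers of `z` in `a(z)` carry its creation part and stay on the left; the negative powers carry its
annihilation part and are moved to the right, with the sign `s`. -/
def normalOrderTerm (s : ℤˣ) (a b : VertexOperator K V) (k i : ℤ) : End K V :=
  if 0 ≤ i then HVertexOperator.coeff a i * HVertexOperator.coeff b (k - i)
  else s • (HVertexOperator.coeff b (k - i) * HVertexOperator.coeff a i)

theorem normalOrderTerm_finite (s : ℤˣ) (a b : VertexOperator K V) (k : ℤ) (v : V) :
    (Function.support fun i => normalOrderTerm s a b k i v).Finite := by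
  obtain ⟨N, hN⟩ := exists_coeff_eq_zero a v
  obtain ⟨M, hM⟩ := exists_coeff_eq_zero b v
  refine (Set.finite_Icc (min N 0) (max 0 (k - M))).subset fun i hi => ?_
  by_cases h0 : 0 ≤ i
  · refine ⟨by omega, ?_⟩
    by_contra h
    apply hi
    have : HVertexOperator.coeff b (k - i) v = 0 := hM _ (by omega)
    simp only [normalOrderTerm, if_pos h0, Module.End.mul_apply]
    rw [this, map_zero]
  · refine ⟨?_, by omega⟩
    by_contra h
    apply hi
    have : HVertexOperator.coeff a i v = 0 := hN _ (by omega)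
    simp only [normalOrderTerm, if_neg h0, Units.smul_def, LinearMap.smul_apply,
      Module.End.mul_apply]
    rw [this, map_zero, smul_zero]

theorem normalOrder_truncated (s : ℤˣ) (a b : VertexOperator K V) (v : V) :
    ∃ N : ℤ, ∀ k < N, locSum (normalOrderTerm s a b k) (normalOrderTerm_finite s a b k) v = 0 := by
  obtain ⟨N, hN⟩ := exists_coeff_eq_zero a v
  obtain ⟨M, hM⟩ := exists_coeff_eq_zero b v
  choose B hB using fun i => exists_coeff_eq_zero b (HVertexOperator.coeff a i v)
  obtain ⟨C, hC⟩ := ((Set.finite_Icc N 0).image B).bddBelow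
  refine ⟨min M (C + N), fun k hk => ?_⟩
  refine finsum_eq_zero_of_forall_eq_zero fun i => ?_
  by_cases h0 : 0 ≤ i
  · have : HVertexOperator.coeff b (k - i) v = 0 := hM _ (by omega)
    simp only [normalOrderTerm, if_pos h0, Module.End.mul_apply]
    rw [this, map_zero]
  · simp only [normalOrderTerm, if_neg h0, Units.smul_def, LinearMap.smul_apply,
      Module.End.mul_apply]
    by_cases hi : i < N
    · rw [hN i hi, map_zero, smul_zero]
    · have h1 : C ≤ B i := hC ⟨i, ⟨by omega, by omega⟩, rfl⟩
      rw [hB i (k - i) (by omega), smul_zero]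

/-- The normally ordered product `:a(z)b(z): = a(z)⁻ b(z) + s b(z) a(z)⁺`, where `a(z)⁻` and
`a(z)⁺` are the creation and the annihilation half of `a(z)`; the sign `s` is `-1` if both fields
are odd and `1` otherwise. -/
def normalOrder (s : ℤˣ) (a b : VertexOperator K V) : VertexOperator K V :=
  mkField (fun k => locSum (normalOrderTerm s a b k) (normalOrderTerm_finite s a b k))
    (normalOrder_truncated s a b)

/-- The supercommutator of two operators of superdegrees `p` and `q`. -/
def superBracket (p q : ℤ) (A B : End K V) : End K V :=
  A * B - (p * q).negOnePow • (B * A)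

/-- The supercommutator `[A, a(z)]` of an operator of superdegree `p` with a field of superdegree
`q`, taken coefficientwise. -/
def superBracketField (p q : ℤ) (A : End K V) (a : VertexOperator K V) : VertexOperator K V :=
  mkField (fun k => superBracket p q A (HVertexOperator.coeff a k)) fun v => by
    obtain ⟨N, hN⟩ := exists_coeff_eq_zero a v
    obtain ⟨M, hM⟩ := exists_coeff_eq_zero a (A v)
    refine ⟨min N M, fun k hk => ?_⟩
    have h1 : HVertexOperator.coeff a k v = 0 := hN _ (by omega)
    have h2 : HVertexOperator.coeff a k (A v) = 0 := hM _ (by omega)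
    simp only [superBracket, LinearMap.sub_apply, Units.smul_def, LinearMap.smul_apply,
      Module.End.mul_apply]
    rw [h1, h2, map_zero, smul_zero, sub_zero]

/-- The field `a(z)` corresponds to the state `s`: `a(z) vac` has no negative powers of `z`, and
its constant term is `s`. -/
def Creates (vac : V) (a : VertexOperator K V) (s : V) : Prop :=
  (∀ k < 0, HVertexOperator.coeff a k vac = 0) ∧ HVertexOperator.coeff a 0 vac = s

/-- The Virasoro mode `Lₙ` of a stress-energy field `L(z) = ∑ Lₙ z⁻ⁿ⁻²`. -/
def virMode (L : VertexOperator K V) (n : ℤ) : End K V :=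
  HVertexOperator.coeff L (-n - 2)

/-- The field `a(z)` has weight `w`: the corresponding state has `L₀`-eigenvalue `w`. -/
def HasWeight (vac : V) (L a : VertexOperator K V) (w : ℤ) : Prop :=
  ∃ s, Creates vac a s ∧ virMode L 0 s = w • s

/-- The field `a(z)` is primary (Virasoro-singular) of weight `w`: the corresponding state has
`L₀`-eigenvalue `w` and is killed by all `Lₙ` with `n > 0`. -/
def IsPrimary (vac : V) (L a : VertexOperator K V) (w : ℤ) : Prop :=
  ∃ s, Creates vac a s ∧ virMode L 0 s = w • s ∧ ∀ n > 0, virMode L n s = 0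

/-- All modes of `a(z)` shift the grading `deg` (the fermion number) by `d`. -/
def HasFermionNumber (deg : ℤ → Submodule K V) (a : VertexOperator K V) (d : ℤ) : Prop :=
  ∀ k j, ∀ v ∈ deg j, HVertexOperator.coeff a k v ∈ deg (j + d)

/-- The data of a topological chiral algebra on a space with vacuum `vac`, fermion number grading
`deg` and stress-energy field `L(z)`: fields `F(z)`, `J(z)`, `G(z)` with the properties below.
For `σ = 1` these are the usual conditions; for `σ = -1` the fermion numbers of `J(z)` and `G(z)`
are interchanged, that is, the charge of `J(z)` lowers the fermion number. -/
structure IsTCAReduction (vac : V) (deg : ℤ → Submodule K V) (σ : ℤ)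
    (L F J G : VertexOperator K V) : Prop where
  F_weight : HasWeight vac L F 1
  F_even : HasFermionNumber deg F 0
  F_charge : ∀ j, ∀ v ∈ deg j, VertexOperator.ncoeff F 0 v = j • v
  J_primary : IsPrimary vac L J 1
  J_fermion : HasFermionNumber deg J σ
  J_charge : VertexOperator.ncoeff J 0 * VertexOperator.ncoeff J 0 = 0
  G_primary : IsPrimary vac L G 2
  G_fermion : HasFermionNumber deg G (-σ)
  bracket : superBracketField σ (-σ) (VertexOperator.ncoeff J 0) G = L

end Fields

/-! ### The Clifford and Weyl algebras of the loop space and their vacuum modules -/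

section Algebras

variable (K ℓ : Type*) [CommRing K] [AddCommGroup ℓ] [Module K ℓ]

/-- The space `ℓ ⊗ K[t, t⁻¹] ⊕ (its restricted dual)`. In the first summand `single n x` stands for
`x ⊗ tⁿ`; in the second one `single n ξ` stands for `ξ` placed in `Hom(ℓ ⊗ t⁻ⁿ, K)`. -/
abbrev Gens : Type _ := (ℤ →₀ ℓ) × (ℤ →₀ Dual K ℓ)

/-- The pairing of the restricted dual with the loop space: `⟨ξₙ, xₘ⟩ = ξ(x) δ_{n+m,0}`. -/
def pairing : (ℤ →₀ Dual K ℓ) →ₗ[K] (ℤ →₀ ℓ) →ₗ[K] K :=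
  Finsupp.lsum K fun n => LinearMap.lcomp K K (Finsupp.lapply (-n))

/-- The quadratic form `(x, ξ) ↦ ⟨ξ, x⟩`. -/
def cliffordForm : QuadraticForm K (Gens K ℓ) :=
  LinearMap.BilinMap.toQuadraticMap
    ((pairing K ℓ).compl₁₂ (LinearMap.snd K _ _) (LinearMap.fst K _ _))

/-- The Clifford algebra on the loop space: `cb + bc = ⟨c, b⟩`, `bb' + b'b = 0`, `cc' + c'c = 0`. -/
abbrev Cliff : Type _ := CliffordAlgebra (R := K) (M := Gens K ℓ) (cliffordForm K ℓ)

/-- The generators of the Clifford algebra. -/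
def cliffι : Gens K ℓ →ₗ[K] Cliff K ℓ :=
  CliffordAlgebra.ι (R := K) (M := Gens K ℓ) (cliffordForm K ℓ)

/-- The relations `uv - vu = ⟨u₂, v₁⟩ - ⟨v₂, u₁⟩` of the Weyl algebra, i.e. `γβ - βγ = ⟨γ, β⟩`,
`ββ' - β'β = 0`, `γγ' - γ'γ = 0`. -/
inductive WeylRel : TensorAlgebra K (Gens K ℓ) → TensorAlgebra K (Gens K ℓ) → Prop
  | comm (u v : Gens K ℓ) : WeylRel (TensorAlgebra.ι K u * TensorAlgebra.ι K v)
      (TensorAlgebra.ι K v * TensorAlgebra.ι K u +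
        algebraMap K _ (pairing K ℓ u.2 v.1 - pairing K ℓ v.2 u.1))

/-- The Weyl algebra on the loop space. -/
abbrev Weyl : Type _ := RingQuot (WeylRel K ℓ)

/-- The generators of the Weyl algebra. -/
def weylι : Gens K ℓ →ₗ[K] Weyl K ℓ :=
  (RingQuot.mkAlgHom K (WeylRel K ℓ)).toLinearMap ∘ₗ TensorAlgebra.ι K

/-- The annihilation operators: `bₙ`, `βₙ` with `n ≥ 0` and `cₙ`, `γₙ` with `n ≥ 1`. -/
def annihilators : Set (Gens K ℓ) :=
  {g | (∃ n : ℤ, 0 ≤ n ∧ ∃ x, g = (Finsupp.single n x, 0)) ∨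
    ∃ n : ℤ, 1 ≤ n ∧ ∃ ξ, g = (0, Finsupp.single n ξ)}

/-- The semi-infinite symmetric module: the Weyl module induced from the trivial representation of
the subalgebra generated by the annihilation operators. -/
abbrev SymMod : Type _ := Weyl K ℓ ⧸ Submodule.span (Weyl K ℓ) (weylι K ℓ '' annihilators K ℓ)

/-- The semi-infinite exterior module: the Clifford module induced from the trivial representation
of the subalgebra generated by the annihilation operators. -/
abbrev ExtMod : Type _ :=
  Cliff K ℓ ⧸ Submodule.span (Cliff K ℓ) (cliffι K ℓ '' annihilators K ℓ)

/-- The vertex operator Weil algebra, as a vector space. -/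
abbrev Space : Type _ := SymMod K ℓ ⊗[K] ExtMod K ℓ

/-- The vacuum. -/
def vac : Space K ℓ := Submodule.Quotient.mk 1 ⊗ₜ Submodule.Quotient.mk 1

/-- The action of the generators of the Weyl algebra on the first tensor factor. -/
def symAct : Gens K ℓ →ₗ[K] End K (Space K ℓ) :=
  LinearMap.rTensorHom _ ∘ₗ (Algebra.lsmul K K (SymMod K ℓ)).toLinearMap ∘ₗ weylι K ℓ

/-- The action of the generators of the Clifford algebra on the second tensor factor. -/
def extAct : Gens K ℓ →ₗ[K] End K (Space K ℓ) :=
  LinearMap.lTensorHom _ ∘ₗ (Algebra.lsmul K K (ExtMod K ℓ)).toLinearMap ∘ₗ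
    cliffι K ℓ

/-- The generator `g` is a mode of index `n`. -/
def IsMode (n : ℤ) (g : Gens K ℓ) : Prop :=
  (∃ x, g = (Finsupp.single n x, 0)) ∨ ∃ ξ, g = (0, Finsupp.single n ξ)

theorem pairing_single_left (n : ℤ) (ξ : Dual K ℓ) (f : ℤ →₀ ℓ) :
    pairing K ℓ (Finsupp.single n ξ) f = ξ (f (-n)) := by
  simp [pairing]

theorem pairing_single_right (n : ℤ) (x : ℓ) (f : ℤ →₀ Dual K ℓ) :
    pairing K ℓ f (Finsupp.single n x) = f (-n) x := by
  induction f using Finsupp.induction_linear with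
  | zero => simp
  | add f g hf hg => simp [hf, hg]
  | single m ξ =>
    rw [pairing_single_left]
    by_cases h : n = -m
    · subst h; simp
    · rw [Finsupp.single_eq_of_ne (by omega), Finsupp.single_eq_of_ne (by omega)]
      simp

theorem pairing_eventually_zero (g : Gens K ℓ) :
    ∃ N : ℤ, ∀ n ≥ N, ∀ u, IsMode K ℓ n u → pairing K ℓ u.2 g.1 = 0 ∧ pairing K ℓ g.2 u.1 = 0 := by
  obtain ⟨A, hA⟩ := (g.1.support.finite_toSet).bddBelow
  obtain ⟨B, hB⟩ := (g.2.support.finite_toSet).bddBelow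
  refine ⟨1 - min A B, fun n hn u hu => ?_⟩
  have h1 : g.1 (-n) = 0 := by
    by_contra h
    have := hA (Finset.mem_coe.mpr (Finsupp.mem_support_iff.mpr h))
    omega
  have h2 : g.2 (-n) = 0 := by
    by_contra h
    have := hB (Finset.mem_coe.mpr (Finsupp.mem_support_iff.mpr h))
    omega
  rcases hu with ⟨x, rfl⟩ | ⟨ξ, rfl⟩
  · simp [pairing_single_right, h2]
  · simp [pairing_single_left, h1]

theorem weylι_comm (u v : Gens K ℓ) : weylι K ℓ u * weylι K ℓ v = weylι K ℓ v * weylι K ℓ u +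
    algebraMap K _ (pairing K ℓ u.2 v.1 - pairing K ℓ v.2 u.1) := by
  have := RingQuot.mkAlgHom_rel K (WeylRel.comm u v)
  simpa only [weylι, LinearMap.comp_apply, AlgHom.toLinearMap_apply, map_mul, map_add, AlgHom.commutes] using this

theorem cliffι_comm (u v : Gens K ℓ) :
    cliffι K ℓ u * cliffι K ℓ v =
      -(cliffι K ℓ v * cliffι K ℓ u) +
        algebraMap K _ (pairing K ℓ u.2 v.1 + pairing K ℓ v.2 u.1) := by
  rw [cliffι, CliffordAlgebra.ι_mul_ι_comm, neg_add_eq_sub]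
  congr 2
  simp [cliffordForm, LinearMap.BilinMap.polar_toQuadraticMap]

/-- On the symmetric module every vector is killed by all modes of large index. -/
theorem symMod_eventually_zero (s : SymMod K ℓ) :
    ∃ N : ℤ, ∀ n ≥ N, ∀ u, IsMode K ℓ n u → weylι K ℓ u • s = 0 := by
  let P : SymMod K ℓ → Prop := fun s =>
    ∃ N : ℤ, ∀ n ≥ N, ∀ u, IsMode K ℓ n u → weylι K ℓ u • s = 0
  have key : ∀ a : TensorAlgebra K (Gens K ℓ), ∀ s, P s →
      P (RingQuot.mkAlgHom K (WeylRel K ℓ) a • s) := by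
    intro a
    induction a using TensorAlgebra.induction with
    | algebraMap r =>
      rintro s ⟨N, hN⟩
      refine ⟨N, fun n hn u hu => ?_⟩
      rw [AlgHom.commutes, algebraMap_smul, smul_comm, hN n hn u hu, smul_zero]
    | ι g =>
      rintro s ⟨N, hN⟩
      obtain ⟨M, hM⟩ := pairing_eventually_zero K ℓ g
      refine ⟨max N M, fun n hn u hu => ?_⟩
      obtain ⟨h1, h2⟩ := hM n (le_trans (le_max_right _ _) hn) u hu
      change weylι K ℓ u • weylι K ℓ g • s = 0
      rw [← mul_smul, weylι_comm, h1, h2, sub_zero, map_zero, add_zero, mul_smul,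
        hN n (le_trans (le_max_left _ _) hn) u hu, smul_zero]
    | mul a b ha hb =>
      intro s hs
      rw [map_mul, mul_smul]
      exact ha _ (hb _ hs)
    | add a b ha hb =>
      intro s hs
      obtain ⟨N, hN⟩ := ha s hs
      obtain ⟨M, hM⟩ := hb s hs
      refine ⟨max N M, fun n hn u hu => ?_⟩
      rw [map_add, add_smul, smul_add, hN n (le_trans (le_max_left _ _) hn) u hu,
        hM n (le_trans (le_max_right _ _) hn) u hu, add_zero]
  have hvac : P (Submodule.Quotient.mk 1) := by
    refine ⟨1, fun n hn u hu => ?_⟩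
    rw [← Submodule.Quotient.mk_smul, Submodule.Quotient.mk_eq_zero, smul_eq_mul, mul_one]
    refine Submodule.subset_span ⟨u, ?_, rfl⟩
    rcases hu with ⟨x, rfl⟩ | ⟨ξ, rfl⟩
    · exact Or.inl ⟨n, by omega, x, rfl⟩
    · exact Or.inr ⟨n, hn, ξ, rfl⟩
  obtain ⟨a, rfl⟩ := Submodule.Quotient.mk_surjective _ s
  obtain ⟨a, rfl⟩ := RingQuot.mkAlgHom_surjective K (WeylRel K ℓ) a
  have := key a _ hvac
  rwa [← Submodule.Quotient.mk_smul, smul_eq_mul, mul_one] at this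

/-- On the exterior module every vector is killed by all modes of large index. -/
theorem extMod_eventually_zero (s : ExtMod K ℓ) :
    ∃ N : ℤ, ∀ n ≥ N, ∀ u, IsMode K ℓ n u →
      cliffι K ℓ u • s = 0 := by
  let P : ExtMod K ℓ → Prop := fun s =>
    ∃ N : ℤ, ∀ n ≥ N, ∀ u, IsMode K ℓ n u → cliffι K ℓ u • s = 0
  have key : ∀ a : Cliff K ℓ, ∀ s, P s → P (a • s) := by
    intro a
    induction a using CliffordAlgebra.induction with
    | algebraMap r =>
      rintro s ⟨N, hN⟩
      refine ⟨N, fun n hn u hu => ?_⟩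
      rw [algebraMap_smul, smul_comm, hN n hn u hu, smul_zero]
    | ι g =>
      rintro s ⟨N, hN⟩
      obtain ⟨M, hM⟩ := pairing_eventually_zero K ℓ g
      refine ⟨max N M, fun n hn u hu => ?_⟩
      obtain ⟨h1, h2⟩ := hM n (le_trans (le_max_right _ _) hn) u hu
      change cliffι K ℓ u • cliffι K ℓ g • s = 0
      rw [← mul_smul, cliffι_comm, h1, h2, add_zero, map_zero, add_zero, neg_smul, mul_smul,
        hN n (le_trans (le_max_left _ _) hn) u hu, smul_zero, neg_zero]
    | mul a b ha hb =>
      intro s hs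
      rw [mul_smul]
      exact ha _ (hb _ hs)
    | add a b ha hb =>
      intro s hs
      obtain ⟨N, hN⟩ := ha s hs
      obtain ⟨M, hM⟩ := hb s hs
      refine ⟨max N M, fun n hn u hu => ?_⟩
      rw [add_smul, smul_add, hN n (le_trans (le_max_left _ _) hn) u hu,
        hM n (le_trans (le_max_right _ _) hn) u hu, add_zero]
  have hvac : P (Submodule.Quotient.mk 1) := by
    refine ⟨1, fun n hn u hu => ?_⟩
    rw [← Submodule.Quotient.mk_smul, Submodule.Quotient.mk_eq_zero, smul_eq_mul, mul_one]
    refine Submodule.subset_span ⟨u, ?_, rfl⟩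
    rcases hu with ⟨x, rfl⟩ | ⟨ξ, rfl⟩
    · exact Or.inl ⟨n, by omega, x, rfl⟩
    · exact Or.inr ⟨n, hn, ξ, rfl⟩
  obtain ⟨a, rfl⟩ := Submodule.Quotient.mk_surjective _ s
  have := key a _ hvac
  rwa [← Submodule.Quotient.mk_smul, smul_eq_mul, mul_one] at this

/-- Every vector is killed by all modes of large index. -/
theorem eventually_zero (v : Space K ℓ) : ∃ N : ℤ, ∀ n ≥ N, ∀ u, IsMode K ℓ n u →
    symAct K ℓ u v = 0 ∧ extAct K ℓ u v = 0 := by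
  induction v using TensorProduct.induction_on with
  | zero => exact ⟨0, fun n _ u _ => ⟨map_zero _, map_zero _⟩⟩
  | tmul s t =>
    obtain ⟨N, hN⟩ := symMod_eventually_zero K ℓ s
    obtain ⟨M, hM⟩ := extMod_eventually_zero K ℓ t
    refine ⟨max N M, fun n hn u hu => ⟨?_, ?_⟩⟩
    · change (weylι K ℓ u • s) ⊗ₜ[K] t = 0
      rw [hN n (le_trans (le_max_left _ _) hn) u hu, TensorProduct.zero_tmul]
    · change s ⊗ₜ[K] (cliffι K ℓ u • t) = 0
      rw [hM n (le_trans (le_max_right _ _) hn) u hu, TensorProduct.tmul_zero]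
  | add v w hv hw =>
    obtain ⟨N, hN⟩ := hv
    obtain ⟨M, hM⟩ := hw
    refine ⟨max N M, fun n hn u hu => ?_⟩
    obtain ⟨h1, h2⟩ := hN n (le_trans (le_max_left _ _) hn) u hu
    obtain ⟨h3, h4⟩ := hM n (le_trans (le_max_right _ _) hn) u hu
    exact ⟨by rw [map_add, h1, h3, add_zero], by rw [map_add, h2, h4, add_zero]⟩

/-- The two tensor factors commute. -/
theorem symAct_extAct_comm (u g : Gens K ℓ) (v : Space K ℓ) :
    symAct K ℓ u (extAct K ℓ g v) = extAct K ℓ g (symAct K ℓ u v) := by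
  induction v using TensorProduct.induction_on with
  | zero => simp only [map_zero]
  | tmul s t => rfl
  | add v w hv hw => simp only [map_add, hv, hw]

end Algebras

/-! ### Modes, fields, operators and states -/

section Operators

variable {K ℓ : Type*} [CommRing K] [AddCommGroup ℓ] [Module K ℓ]

/-- The mode `βₙ` of `x ∈ ℓ`. -/
def betaMode (x : ℓ) (n : ℤ) : End K (Space K ℓ) := symAct K ℓ (Finsupp.single n x, 0)

/-- The mode `γₙ` of `ξ ∈ ℓ'`. -/
def gammaMode (ξ : Dual K ℓ) (n : ℤ) : End K (Space K ℓ) := symAct K ℓ (0, Finsupp.single n ξ)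

/-- The mode `bₙ` of `x ∈ ℓ`. -/
def bMode (x : ℓ) (n : ℤ) : End K (Space K ℓ) := extAct K ℓ (Finsupp.single n x, 0)

/-- The mode `cₙ` of `ξ ∈ ℓ'`. -/
def cMode (ξ : Dual K ℓ) (n : ℤ) : End K (Space K ℓ) := extAct K ℓ (0, Finsupp.single n ξ)

/-- `β(z) = ∑ βₙ z⁻ⁿ⁻¹`. -/
def betaField (x : ℓ) : VertexOperator K (Space K ℓ) :=
  mkField (fun k => betaMode x (-k - 1)) fun v => by
    obtain ⟨N, hN⟩ := eventually_zero K ℓ v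
    exact ⟨-N, fun k hk => (hN (-k - 1) (by omega) _ (Or.inl ⟨x, rfl⟩)).1⟩

/-- `γ(z) = ∑ γₙ z⁻ⁿ`. -/
def gammaField (ξ : Dual K ℓ) : VertexOperator K (Space K ℓ) :=
  mkField (fun k => gammaMode ξ (-k)) fun v => by
    obtain ⟨N, hN⟩ := eventually_zero K ℓ v
    exact ⟨-N, fun k hk => (hN (-k) (by omega) _ (Or.inr ⟨ξ, rfl⟩)).1⟩

/-- `b(z) = ∑ bₙ z⁻ⁿ⁻¹`. -/
def bField (x : ℓ) : VertexOperator K (Space K ℓ) :=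
  mkField (fun k => bMode x (-k - 1)) fun v => by
    obtain ⟨N, hN⟩ := eventually_zero K ℓ v
    exact ⟨-N, fun k hk => (hN (-k - 1) (by omega) _ (Or.inl ⟨x, rfl⟩)).2⟩

/-- `c(z) = ∑ cₙ z⁻ⁿ`. -/
def cField (ξ : Dual K ℓ) : VertexOperator K (Space K ℓ) :=
  mkField (fun k => cMode ξ (-k)) fun v => by
    obtain ⟨N, hN⟩ := eventually_zero K ℓ v
    exact ⟨-N, fun k hk => (hN (-k) (by omega) _ (Or.inr ⟨ξ, rfl⟩)).2⟩

/-- Strings of creation operators applied to the vacuum, with their superdegree: the number of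
`c`'s minus the number of `b`'s. -/
inductive IsMonomial : ℤ → Space K ℓ → Prop
  | vac : IsMonomial 0 (vac K ℓ)
  | beta {j v} (x : ℓ) (n : ℤ) (hn : n ≤ -1) (hv : IsMonomial j v) :
      IsMonomial j (betaMode x n v)
  | gamma {j v} (ξ : Dual K ℓ) (n : ℤ) (hn : n ≤ 0) (hv : IsMonomial j v) :
      IsMonomial j (gammaMode ξ n v)
  | b {j v} (x : ℓ) (n : ℤ) (hn : n ≤ -1) (hv : IsMonomial j v) :
      IsMonomial (j - 1) (bMode x n v)
  | c {j v} (ξ : Dual K ℓ) (n : ℤ) (hn : n ≤ 0) (hv : IsMonomial j v) :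
      IsMonomial (j + 1) (cMode ξ n v)

variable (K ℓ) in
/-- The subspace of superdegree (fermion number) `j`. -/
def superdegree (j : ℤ) : Submodule K (Space K ℓ) := Submodule.span K {v | IsMonomial j v}

variable {ι : Type*} [Fintype ι] (e : Basis ι K ℓ) (φ : ℓ ≃ₗ[K] Dual K ℓ)

theorem symAct_mul_extAct_finite (q : ℤ → K) (g u : ι → ℤ → Gens K ℓ)
    (hg : ∀ i n, IsMode K ℓ (-n) (g i n)) (hu : ∀ i n, IsMode K ℓ n (u i n)) (v : Space K ℓ) :
    (Function.support fun n =>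
      (q n • ∑ i, symAct K ℓ (g i n) * extAct K ℓ (u i n) : End K (Space K ℓ)) v).Finite := by
  obtain ⟨N, hN⟩ := eventually_zero K ℓ v
  refine (Set.finite_Icc (-N) N).subset fun n hn => ?_
  by_contra h
  apply hn
  simp only [LinearMap.smul_apply, LinearMap.sum_apply, Module.End.mul_apply]
  rw [Finset.sum_eq_zero, smul_zero]
  intro i _
  by_cases h1 : N ≤ n
  · rw [(hN n h1 _ (hu i n)).2, map_zero]
  · have h2 : N ≤ -n := by
      by_contra h2
      exact h ⟨by omega, by omega⟩
    rw [symAct_extAct_comm, (hN (-n) h2 _ (hg i n)).1, map_zero]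

/-- The Koszul differential `h = ∑_{u,n} γ₋ₙ^{u'} bₙ^u`. -/
def hOp : End K (Space K ℓ) :=
  locSum (fun n => (1 : K) • ∑ i, gammaMode (e.coord i) (-n) * bMode (e i) n)
    (symAct_mul_extAct_finite _ _ _ (fun i _ => Or.inr ⟨e.coord i, rfl⟩)
      fun i _ => Or.inl ⟨e i, rfl⟩)

/-- The operator `r = ∑_{u,n} n γ₋ₙ^{φ(u)} cₙ^{u'}`. -/
def rOp : End K (Space K ℓ) :=
  locSum (fun n => (n : K) • ∑ i, gammaMode (φ (e i)) (-n) * cMode (e.coord i) n)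
    (symAct_mul_extAct_finite _ _ _ (fun i _ => Or.inr ⟨φ (e i), rfl⟩)
      fun i _ => Or.inr ⟨e.coord i, rfl⟩)

/-- `h(z) = ∑ γ^{u'}(z) b^u(z)`. (The modes of the two factors commute, so the normally ordered
product is the plain product; likewise for `k(z)`, `r(z)` and `t(z)`.) -/
def hField : VertexOperator K (Space K ℓ) :=
  ∑ i, normalOrder 1 (gammaField (e.coord i)) (bField (e i))

/-- `k(z) = ∑ β^u(z) d/dz c^{u'}(z)`. -/
def kField : VertexOperator K (Space K ℓ) :=
  ∑ i, normalOrder 1 (betaField (e i)) (derivField (cField (e.coord i)))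

/-- `r(z) = ∑ γ^{φ(u)}(z) d/dz c^{u'}(z)`. -/
def rField : VertexOperator K (Space K ℓ) :=
  ∑ i, normalOrder 1 (gammaField (φ (e i))) (derivField (cField (e.coord i)))

/-- `t(z) = ∑ β^{φ⁻¹(u')}(z) b^u(z)`. -/
def tField : VertexOperator K (Space K ℓ) :=
  ∑ i, normalOrder 1 (betaField (φ.symm (e.coord i))) (bField (e i))

/-- The Virasoro field `ω(z) = -∑ :b^u(z) d/dz c^{u'}(z): - ∑ :β^u(z) d/dz γ^{u'}(z):`. -/
def omegaField : VertexOperator K (Space K ℓ) :=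
  -(∑ i, normalOrder (-1) (bField (e i)) (derivField (cField (e.coord i)))) -
    ∑ i, normalOrder 1 (betaField (e i)) (derivField (gammaField (e.coord i)))

/-- The fermion number field `F(z) = ∑ :c^{u'}(z) b^u(z):`. -/
def fermionField : VertexOperator K (Space K ℓ) :=
  ∑ i, normalOrder (-1) (cField (e.coord i)) (bField (e i))

/-- The state of `h(z)`: `∑ γ₀^{u'} b₋₁^u vac`. -/
def hState : Space K ℓ := ∑ i, gammaMode (e.coord i) 0 (bMode (e i) (-1) (vac K ℓ))

/-- The state of `k(z)`: `∑ β₋₁^u c₋₁^{u'} vac`. -/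
def kState : Space K ℓ := ∑ i, betaMode (e i) (-1) (cMode (e.coord i) (-1) (vac K ℓ))

/-- The state of `r(z)`: `∑ γ₀^{φ(u)} c₋₁^{u'} vac`. -/
def rState : Space K ℓ := ∑ i, gammaMode (φ (e i)) 0 (cMode (e.coord i) (-1) (vac K ℓ))

/-- The state of `t(z)`: `∑ β₋₁^{φ⁻¹(u')} b₋₁^u vac`. -/
def tState : Space K ℓ := ∑ i, betaMode (φ.symm (e.coord i)) (-1) (bMode (e i) (-1) (vac K ℓ))

/-- The Virasoro element `-∑ b₋₁^u c₋₁^{u'} vac - ∑ β₋₁^u γ₋₁^{u'} vac`. -/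
def omegaState : Space K ℓ :=
  -(∑ i, bMode (e i) (-1) (cMode (e.coord i) (-1) (vac K ℓ))) -
    ∑ i, betaMode (e i) (-1) (gammaMode (e.coord i) (-1) (vac K ℓ))

end Operators

/-- The isomorphism `ℓ ≃ ℓ'` given by the Killing form, up to a choice `s` of its normalization. -/
def killingIso (K ℓ : Type*) [Field K] [LieRing ℓ] [LieAlgebra K ℓ] [FiniteDimensional K ℓ]
    [LieAlgebra.IsKilling K ℓ] (s : Kˣ) : ℓ ≃ₗ[K] Dual K ℓ :=
  (LinearMap.BilinForm.toDual (killingForm K ℓ)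
    (LieAlgebra.IsKilling.killingForm_nondegenerate K ℓ)).trans (LinearEquiv.smulOfUnit s)

end VOWA

end

namespace VOWA

open HVertexOperator (coeff)

/-! ### Calculus of fields: coefficients and normally ordered products. -/

section FieldCalculus

variable {K V : Type*} [CommRing K] [AddCommGroup V] [Module K V]

/-! Both differentials are infinite sums of products of two modes that commute with each other, so a
bracket of such a sum with a single mode reduces to the one term in which a contraction occurs. The
result is linear in the modes. For `h` one finds [h, β(z)] = b(z), {h, c(z)} = γ(z), [h, γ] = 0 and
{h, b} = 0: `h` is an odd derivation replacing β by b and c by γ. The Leibniz rule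
(`superBracketField_normalOrder`) applied to β ∂c then gives :b ∂c: + :β ∂γ:, which is -ω(z). For
`r` one finds [r, β^x(z)] = -∂c^{φ(x)}(z) and {r, b^x(z)} = ∂γ^{φ(x)}(z), with γ and c again sent to
zero. The Leibniz rule for `t` gives the same two summands, once :∂c b: is turned into -:b ∂c:
(`normalOrder_deriv_c_b`) and the bases φ⁻¹(u'), φ(u) are replaced by u, u' in the canonical tensor
(`sum_symm_coord`). Of φ only linearity, bijectivity and the symmetry φ(x)(y) = φ(y)(x) are used.

Each differential D is a sum of products of modes which it supercommutes with, hence D anticommutes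
with itself and 2D² = 0 (`locSum_mul_self_eq_zero`).

The same one-term contraction (`coeff_normalOrder_comm`) computes the brackets of Lₙ and of the
charge of F(z) with the modes. Those of Lₙ are [Lₙ, a_m] = -m a_{n+m} for a = β, b and -(n+m)
a_{n+m} for a = γ, c. Since Lₙ kills the vacuum for n ≥ -1, weights and primarity of the two-mode
states follow. The charge of F(z) lowers by one across b, raises by one across c, commutes with β
and γ and kills the vacuum, so it measures the superdegree.

Finally, if [D, G(z)] = -L(z) and D v = 0, then D(G v) = -L v coefficient by coefficient; this gives
exactness of the Virasoro element and triviality of the Virasoro action on cohomology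
(`exactness_of_bracket`).

All of this uses only the commutation relations, the vacuum conditions, local finiteness and the
minimality of the grading. These are collected in `ModeSystem`, and `weilModes` verifies them for
the actual module. -/

theorem field_ext {a b : VertexOperator K V} (h : ∀ k, coeff a k = coeff b k) : a = b :=
  HVertexOperator.coeff_inj (funext h)

theorem coeff_derivField (a : VertexOperator K V) (k : ℤ) :
    coeff (derivField a) k = (k + 1) • coeff a (k + 1) := rfl

theorem coeff_normalOrder (s : ℤˣ) (a b : VertexOperator K V) (k : ℤ) :
    coeff (normalOrder s a b) k =
      locSum (normalOrderTerm s a b k) (normalOrderTerm_finite s a b k) := rfl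

theorem coeff_superBracketField (p q : ℤ) (A : End K V) (a : VertexOperator K V) (k : ℤ) :
    coeff (superBracketField p q A a) k = superBracket p q A (coeff a k) := rfl

theorem coeff_add (a b : VertexOperator K V) (k : ℤ) :
    coeff (a + b) k = coeff a k + coeff b k := by rw [map_add, Pi.add_apply]

theorem coeff_sub (a b : VertexOperator K V) (k : ℤ) :
    coeff (a - b) k = coeff a k - coeff b k := by rw [map_sub, Pi.sub_apply]

theorem coeff_neg (a : VertexOperator K V) (k : ℤ) : coeff (-a) k = -coeff a k := by
  rw [map_neg, Pi.neg_apply]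

theorem coeff_smul (c : K) (a : VertexOperator K V) (k : ℤ) :
    coeff (c • a) k = c • coeff a k := by rw [map_smul, Pi.smul_apply]

theorem coeff_sum {ι : Type*} (t : Finset ι) (a : ι → VertexOperator K V) (k : ℤ) :
    coeff (∑ i ∈ t, a i) k = ∑ i ∈ t, coeff (a i) k := by rw [map_sum, Finset.sum_apply]

/-! ### Locally finite sums -/

theorem locSum_apply (f : ℤ → End K V) (hf) (v : V) : locSum f hf v = ∑ᶠ n, f n v := rfl

theorem locSum_mem {f : ℤ → End K V} (hf) {v : V} {p : Submodule K V} (h : ∀ n, f n v ∈ p) :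
    locSum f hf v ∈ p :=
  finsum_induction (· ∈ p) p.zero_mem (fun _ _ => p.add_mem) h

theorem locSum_add {f g h : ℤ → End K V} (hf) (hg) (hh) (H : ∀ n, h n = f n + g n) :
    locSum h hh = locSum f hf + locSum g hg := by
  ext v
  simp only [locSum_apply, H, LinearMap.add_apply]
  exact finsum_add_distrib (hf v) (hg v)

theorem locSum_sum {ι : Type*} [Fintype ι] {f : ι → ℤ → End K V} {h : ℤ → End K V}
    (hf : ∀ i v, (Function.support fun n => f i n v).Finite) (hh) (H : ∀ n, h n = ∑ i, f i n) : locSum h hh = ∑ i, locSum (f i) (hf i) := by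
  ext v
  simp only [locSum_apply, H, LinearMap.sum_apply]
  exact finsum_sum_comm _ _ fun i _ => hf i v

theorem locSum_smul (c : K) {f h : ℤ → End K V} (hf) (hh) (H : ∀ n, h n = c • f n) :
    locSum h hh = c • locSum f hf := by
  ext v
  simp only [locSum_apply, H, LinearMap.smul_apply]
  exact (smul_finsum' c (hf v)).symm

/-- If every term of `h` is the sum of `D f` and `f D` up to a sign, so is the sum. -/
theorem locSum_bracket (D : End K V) (ε : ℤˣ) {f h : ℤ → End K V} (hf) (hh)
    (H : ∀ n, D * f n - ε • (f n * D) = h n) :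
    D * locSum f hf - ε • (locSum f hf * D) = locSum h hh := by
  ext v
  have h1 : (Function.support fun n => D (f n v)).Finite :=
    (hf v).subset fun n hn h0 => hn (by simp [h0])
  have h2 : (Function.support fun n => (ε : ℤ) • f n (D v)).Finite :=
    (hf (D v)).subset fun n hn h0 => hn (by simp [h0])
  have h3 : ∑ᶠ n, (ε : ℤ) • f n (D v) = (ε : ℤ) • ∑ᶠ n, f n (D v) :=
    (smul_finsum' (ε : ℤ) (hf (D v))).symm
  simp only [locSum_apply, ← H, LinearMap.sub_apply, Units.smul_def, LinearMap.smul_apply,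
    Module.End.mul_apply]
  rw [finsum_sub_distrib h1 h2, h3, map_finsum D (hf v)]

theorem locSum_eq_single {f : ℤ → End K V} (hf) (n₀ : ℤ) (h : ∀ n ≠ n₀, f n = 0) :
    locSum f hf = f n₀ := by
  ext v
  rw [locSum_apply, finsum_eq_single _ n₀ fun n hn => by rw [h n hn, LinearMap.zero_apply]]

/-- This is what makes brackets with infinite quadratic sums computable: a mode contracts with at
most one term, so all other terms drop out. With `ε = 1` it is a commutator, with `ε = -1` an
anticommutator. -/
theorem locSum_bracket_eq_single (D : End K V) (ε : ℤˣ) {f : ℤ → End K V} (hf) (n₀ : ℤ)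
    (h : ∀ n ≠ n₀, D * f n - ε • (f n * D) = 0) :
    D * locSum f hf - ε • (locSum f hf * D) = D * f n₀ - ε • (f n₀ * D) := by
  have hh : ∀ v, (Function.support fun n => (D * f n - ε • (f n * D)) v).Finite := fun v =>
    (Set.finite_singleton n₀).subset fun n hn => by
      by_contra h0
      exact hn (by simp only [h n h0, LinearMap.zero_apply])
  rw [locSum_bracket D ε hf hh fun _ => rfl, locSum_eq_single hh n₀ h]

section QuadraticSums

variable {ι : Type*} [Fintype ι] {q : ℤ → K} {G U : ι → ℤ → End K V} {A : End K V}

/-- The commutator of a sum of products `GU` with an operator that commutes with all `U` and has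
scalar commutators with the `G`, nonzero only in the `n₀`-th term. -/
theorem locSum_mul_comm_left (hf) (g : ι → ℤ → K)
    (hG : ∀ i n, G i n * A = A * G i n + g i n • 1) (hU : ∀ i n, Commute (U i n) A) (n₀ : ℤ)
    (hg : ∀ n ≠ n₀, ∀ i, g i n = 0) :
    locSum (fun n => q n • ∑ i, G i n * U i n) hf * A -
      A * locSum (fun n => q n • ∑ i, G i n * U i n) hf = q n₀ • ∑ i, g i n₀ • U i n₀ := by
  have key : ∀ n, A * (q n • ∑ i, G i n * U i n) - (1 : ℤˣ) • ((q n • ∑ i, G i n * U i n) * A) =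
      -(q n • ∑ i, g i n • U i n) := by
    intro n
    have : ∀ i, G i n * U i n * A = A * (G i n * U i n) + g i n • U i n := fun i => by
      rw [mul_assoc, (hU i n).eq, ← mul_assoc, hG, add_mul, smul_mul_assoc, one_mul, mul_assoc]
    simp only [one_smul, smul_mul_assoc, mul_smul_comm, Finset.sum_mul, Finset.mul_sum, this,
      Finset.sum_add_distrib, smul_add]
    abel
  have := locSum_bracket_eq_single A 1 hf n₀ fun n hn => by
    rw [key]
    simp [hg n hn]
  rw [key, one_smul] at this
  -- The bracket lemma keeps the fixed operator on the left, whereas here the sum comes first; hence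
  -- the overall sign.
  rw [← neg_sub, this, neg_neg]

/-- The anticommutator of a sum of products `GU` with an operator that commutes with all `G` and
has scalar anticommutators with the `U`, nonzero only in the `n₀`-th term. -/
theorem locSum_mul_anticomm_right (hf) (u : ι → ℤ → K) (hG : ∀ i n, Commute (G i n) A)
    (hU : ∀ i n, U i n * A = -(A * U i n) + u i n • 1) (n₀ : ℤ)
    (hu : ∀ n ≠ n₀, ∀ i, u i n = 0) :
    locSum (fun n => q n • ∑ i, G i n * U i n) hf * A +
      A * locSum (fun n => q n • ∑ i, G i n * U i n) hf = q n₀ • ∑ i, u i n₀ • G i n₀ := by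
  have key : ∀ n, A * (q n • ∑ i, G i n * U i n) -
      (-1 : ℤˣ) • ((q n • ∑ i, G i n * U i n) * A) = q n • ∑ i, u i n • G i n := by
    intro n
    have : ∀ i, G i n * U i n * A = -(A * (G i n * U i n)) + u i n • G i n := fun i => by
      rw [mul_assoc, hU, mul_add, mul_neg, ← mul_assoc, (hG i n).eq, mul_smul_comm, mul_one,
        mul_assoc]
    simp only [Units.neg_smul, one_smul, smul_mul_assoc, mul_smul_comm, Finset.sum_mul,
      Finset.mul_sum, this, Finset.sum_add_distrib, smul_add, Finset.sum_neg_distrib, smul_neg]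
    abel
  have := locSum_bracket_eq_single A (-1) hf n₀ fun n hn => by
    rw [key]
    simp [hu n hn]
  rw [key, Units.neg_smul, one_smul, sub_neg_eq_add] at this
  rw [add_comm, this]

/-- A sum of products `GU` squares to zero if it commutes with all `G` and anticommutes with
all `U`. -/
theorem locSum_mul_self_eq_zero [IsDomain K] [CharZero K] [Module.IsTorsionFree K V] (hf)
    {D : End K V} (hD : D = locSum (fun n => q n • ∑ i, G i n * U i n) hf)
    (hG : ∀ i n, D * G i n - G i n * D = 0) (hU : ∀ i n, D * U i n + U i n * D = 0) :
    D * D = 0 := by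
  have key : ∀ n, D * (q n • ∑ i, G i n * U i n) -
      (-1 : ℤˣ) • ((q n • ∑ i, G i n * U i n) * D) = 0 := by
    intro n
    have : ∀ i, G i n * U i n * D = -(D * (G i n * U i n)) := fun i => by
      rw [mul_assoc, eq_neg_of_add_eq_zero_right (hU i n), mul_neg, ← mul_assoc, ← mul_assoc,
        sub_eq_zero.mp (hG i n)]
    simp only [Units.neg_smul, one_smul, smul_mul_assoc, mul_smul_comm, Finset.sum_mul,
      Finset.mul_sum, this, Finset.sum_neg_distrib, smul_neg]
    abel
  -- Every term anticommutes with `D`, so the distinguished index 0 is arbitrary. The outcome is D D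
  -- + D D = 0, and 2 is cancelled on vectors.
  have := locSum_bracket_eq_single D (-1) hf 0 fun n _ => key n
  rw [key, Units.neg_smul, one_smul, sub_neg_eq_add, ← hD, ← two_smul K] at this
  ext v
  have h2 := LinearMap.congr_fun this v
  rw [LinearMap.smul_apply, LinearMap.zero_apply] at h2
  exact (smul_eq_zero.mp h2).resolve_left two_ne_zero

end QuadraticSums

/-! ### Normally ordered products -/

theorem normalOrder_add_left (s : ℤˣ) (a a' b : VertexOperator K V) :
    normalOrder s (a + a') b = normalOrder s a b + normalOrder s a' b := by
  refine field_ext fun k => ?_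
  rw [coeff_add]
  refine locSum_add (normalOrderTerm_finite _ _ _ k) (normalOrderTerm_finite _ _ _ k)
    (normalOrderTerm_finite _ _ _ k) fun i => ?_
  simp only [normalOrderTerm, coeff_add, add_mul, mul_add, smul_add]
  split_ifs <;> rfl

theorem normalOrder_add_right (s : ℤˣ) (a b b' : VertexOperator K V) :
    normalOrder s a (b + b') = normalOrder s a b + normalOrder s a b' := by
  refine field_ext fun k => ?_
  rw [coeff_add]
  refine locSum_add (normalOrderTerm_finite _ _ _ k) (normalOrderTerm_finite _ _ _ k)
    (normalOrderTerm_finite _ _ _ k) fun i => ?_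
  simp only [normalOrderTerm, coeff_add, add_mul, mul_add, smul_add]
  split_ifs <;> rfl

theorem normalOrder_smul_left (s : ℤˣ) (c : K) (a b : VertexOperator K V) :
    normalOrder s (c • a) b = c • normalOrder s a b := by
  refine field_ext fun k => ?_
  rw [coeff_smul]
  refine locSum_smul c (normalOrderTerm_finite _ _ _ k) (normalOrderTerm_finite _ _ _ k) fun i => ?_
  simp only [normalOrderTerm, coeff_smul, smul_mul_assoc, mul_smul_comm, Units.smul_def]
  split_ifs
  · rfl
  · rw [smul_comm]

theorem normalOrder_smul_right (s : ℤˣ) (c : K) (a b : VertexOperator K V) :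
    normalOrder s a (c • b) = c • normalOrder s a b := by
  refine field_ext fun k => ?_
  rw [coeff_smul]
  refine locSum_smul c (normalOrderTerm_finite _ _ _ k) (normalOrderTerm_finite _ _ _ k) fun i => ?_
  simp only [normalOrderTerm, coeff_smul, smul_mul_assoc, mul_smul_comm, Units.smul_def]
  split_ifs
  · rfl
  · rw [smul_comm]

variable (K V) in
/-- The normally ordered product as a bilinear map. -/
noncomputable def normalOrderₗ (s : ℤˣ) :
    VertexOperator K V →ₗ[K] VertexOperator K V →ₗ[K] VertexOperator K V :=
  LinearMap.mk₂ K (normalOrder s) (normalOrder_add_left s) (normalOrder_smul_left s)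
    (normalOrder_add_right s) (normalOrder_smul_right s)

theorem normalOrder_neg_left (s : ℤˣ) (a b : VertexOperator K V) :
    normalOrder s (-a) b = -normalOrder s a b :=
  LinearMap.map_neg₂ (normalOrderₗ K V s) a b

/-- Supersymmetry of the normally ordered product of two odd fields whose creation halves and
whose annihilation halves anticommute. -/
theorem normalOrder_swap_odd {a b : VertexOperator K V}
    (h₁ : ∀ i j, 0 ≤ i → 0 ≤ j → coeff a i * coeff b j = -(coeff b j * coeff a i))
    (h₂ : ∀ i j, i < 0 → j < 0 → coeff a i * coeff b j = -(coeff b j * coeff a i)) :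
    normalOrder (-1) a b = -normalOrder (-1) b a := by
  refine field_ext fun k => LinearMap.ext fun v => ?_
  rw [coeff_neg, coeff_normalOrder, coeff_normalOrder, LinearMap.neg_apply, locSum_apply,
    locSum_apply, ← finsum_neg_distrib, ← finsum_comp_equiv (Equiv.subLeft k)]
  refine finsum_congr fun i => ?_
  rw [← LinearMap.neg_apply]
  congr 1
  simp only [normalOrderTerm, Equiv.subLeft_apply, sub_sub_cancel, Units.neg_smul, one_smul]
  -- After the reindexing i ↦ k - i the mixed cases agree by the definition of normal ordering. Only
  -- creation with creation (`h₁`) and annihilation with annihilation (`h₂`) require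
  -- anticommutation.
  split_ifs with hk hi hi
  · exact h₁ _ _ hk hi
  · rw [neg_neg]
  · rfl
  · rw [h₂ _ _ (not_le.mp hk) (not_le.mp hi), neg_neg]

/-- The Leibniz rule for an odd operator and the product of an even and an odd field. -/
theorem superBracketField_normalOrder {p q : ℤ} (hpq : (p * q).negOnePow = -1) {D : End K V}
    {a b a' b' : VertexOperator K V}
    (ha : ∀ k, D * coeff a k - coeff a k * D = coeff a' k)
    (hb : ∀ k, D * coeff b k + coeff b k * D = coeff b' k) :
    superBracketField p q D (normalOrder 1 a b) =
      normalOrder (-1) a' b + normalOrder 1 a b' := by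
  refine field_ext fun k => ?_
  rw [coeff_superBracketField, superBracket, hpq, coeff_add, coeff_normalOrder,
    coeff_normalOrder, coeff_normalOrder]
  have hfin : ∀ v, (Function.support fun i =>
      (normalOrderTerm (-1) a' b k i + normalOrderTerm 1 a b' k i) v).Finite := fun v =>
    ((normalOrderTerm_finite (-1) a' b k v).union (normalOrderTerm_finite 1 a b' k v)).subset
      (Function.support_add _ _)
  rw [← locSum_add _ _ hfin fun _ => rfl]
  refine locSum_bracket D _ _ hfin fun i => ?_
  -- In the reordered half, D b a + b a D = b' a - b a', because the odd `D` meets the odd factor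
  -- first. This minus sign is why `a'` and `b` are normally ordered with sign -1.
  simp only [normalOrderTerm, Units.neg_smul, one_smul, ← ha, ← hb]
  split_ifs <;> noncomm_ring

/-- The commutator of a coefficient of a normally ordered product with an operator that has scalar
supercommutators with both factors, of which only those in the `i₀`-th term are nonzero. -/
theorem coeff_normalOrder_comm (s : ℤˣ) {a b : VertexOperator K V} {A : End K V} {p q : ℤ → K}
    (ha : ∀ i, coeff a i * A = s • (A * coeff a i) + p i • 1)
    (hb : ∀ j, coeff b j * A = s • (A * coeff b j) + q j • 1) (k i₀ : ℤ)
    (hp : ∀ i ≠ i₀, p i = 0) (hq : ∀ i ≠ i₀, q (k - i) = 0) :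
    A * coeff (normalOrder s a b) k - coeff (normalOrder s a b) k * A =
      -(q (k - i₀) • coeff a i₀ + s • p i₀ • coeff b (k - i₀)) := by
  have key : ∀ i, A * normalOrderTerm s a b k i - (1 : ℤˣ) • (normalOrderTerm s a b k i * A) =
      -(q (k - i) • coeff a i + s • p i • coeff b (k - i)) := by
    intro i
    -- `A` passes two factors and picks up `s` twice, so no sign is left and only the contractions
    -- remain. After the factor `s` of the reordered half, `h1` and `h2` yield the same contraction
    -- terms: the ordering does not affect the commutator.
    have h1 : coeff a i * (coeff b (k - i) * A) =
        A * (coeff a i * coeff b (k - i)) + q (k - i) • coeff a i +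
          s • p i • coeff b (k - i) := by
      rw [hb, mul_add, mul_smul_comm, ← mul_assoc, ha]
      rcases Int.units_eq_one_or s with rfl | rfl <;>
        simp only [one_smul, Units.neg_smul, add_mul, neg_mul, mul_assoc, smul_mul_assoc,
          one_mul, mul_one, mul_smul_comm] <;> abel
    have h2 : coeff b (k - i) * (coeff a i * A) =
        A * (coeff b (k - i) * coeff a i) + s • q (k - i) • coeff a i +
          p i • coeff b (k - i) := by
      rw [ha, mul_add, mul_smul_comm, ← mul_assoc, hb]
      rcases Int.units_eq_one_or s with rfl | rfl
      · simp only [one_smul, add_mul, mul_assoc, smul_mul_assoc, one_mul, mul_one, mul_smul_comm]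
      · simp only [one_smul, Units.neg_smul, add_mul, neg_mul, mul_assoc, smul_mul_assoc,
          one_mul, mul_one, mul_smul_comm]
        abel
    rw [one_smul, normalOrderTerm]
    split_ifs
    · rw [mul_assoc, h1]
      abel
    · rw [smul_mul_assoc, mul_assoc, h2]
      rcases Int.units_eq_one_or s with rfl | rfl <;>
        simp only [one_smul, Units.neg_smul, mul_neg] <;> abel
  have := locSum_bracket_eq_single A 1 (normalOrderTerm_finite s a b k) i₀ fun i hi => by
    rw [key, hp i hi, hq i hi, zero_smul, zero_smul, smul_zero, add_zero, neg_zero]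
  rwa [key, one_smul] at this

theorem commute_coeff_derivField {a : VertexOperator K V} {A : End K V}
    (h : ∀ k, Commute (coeff a k) A) (k : ℤ) : Commute (coeff (derivField a) k) A :=
  (h (k + 1)).smul_left (k + 1)

theorem coeff_normalOrder_commute (s : ℤˣ) {a b : VertexOperator K V} {A : End K V}
    (ha : ∀ i, Commute (coeff a i) A) (hb : ∀ j, Commute (coeff b j) A) (k : ℤ) :
    Commute (coeff (normalOrder s a b) k) A := by
  have key : ∀ i, A * normalOrderTerm s a b k i -
      (1 : ℤˣ) • (normalOrderTerm s a b k i * A) = 0 := by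
    intro i
    have : Commute (normalOrderTerm s a b k i) A := by
      rw [normalOrderTerm]
      split_ifs
      · exact (ha i).mul_left (hb _)
      · rw [Units.smul_def]
        exact ((hb _).mul_left (ha i)).smul_left _
    rw [one_smul, this.eq, sub_self]
  have := locSum_bracket_eq_single A 1 (normalOrderTerm_finite s a b k) 0 fun i _ => key i
  rw [key, one_smul, sub_eq_zero] at this
  exact this.symm

/-! ### States -/

/-- In total degree k ≤ 0 the factor on the right has a negative power of z, and so kills the
vacuum, unless k = i = 0. No relation between the two fields is needed. -/
theorem Creates.normalOrder (s : ℤˣ) {vac x y : V} {a b : VertexOperator K V}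
    (ha : Creates vac a x) (hb : Creates vac b y) :
    Creates vac (normalOrder s a b) (coeff a 0 y) := by
  have h : ∀ k ≤ 0, ∀ i, (i ≠ 0 ∨ k ≠ 0) → normalOrderTerm s a b k i vac = 0 := by
    intro k hk i hi
    rw [normalOrderTerm]
    split_ifs with h0
    · rw [Module.End.mul_apply, hb.1 (k - i) (by omega), map_zero]
    · rw [Units.smul_def, LinearMap.smul_apply, Module.End.mul_apply, ha.1 i (by omega), map_zero,
        smul_zero]
  refine ⟨fun k hk => finsum_eq_zero_of_forall_eq_zero fun i => h k hk.le i (Or.inr hk.ne), ?_⟩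
  rw [coeff_normalOrder, locSum_apply,
    finsum_eq_single _ 0 fun i hi => h 0 le_rfl i (Or.inl hi), normalOrderTerm, if_pos le_rfl,
    Module.End.mul_apply, sub_zero, hb.2]

theorem Creates.derivField {vac x : V} {a : VertexOperator K V} (ha : Creates vac a x) :
    Creates vac (derivField a) (coeff a 1 vac) := by
  refine ⟨fun k hk => ?_, ?_⟩
  · rw [coeff_derivField, LinearMap.smul_apply]
    -- At k = -1 the constant term of the field enters, which need not kill the vacuum; its factor k
    -- + 1 is zero.
    rcases eq_or_ne k (-1) with rfl | h
    · rw [neg_add_cancel, zero_smul]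
    · rw [ha.1 (k + 1) (by omega), smul_zero]
  · rw [coeff_derivField, zero_add, one_smul]

theorem Creates.sum {ι : Type*} {t : Finset ι} {vac : V} {x : ι → V} {a : ι → VertexOperator K V}
    (h : ∀ i, Creates vac (a i) (x i)) : Creates vac (∑ i ∈ t, a i) (∑ i ∈ t, x i) := by
  refine ⟨fun k hk => ?_, ?_⟩
  · rw [coeff_sum, LinearMap.sum_apply]
    exact Finset.sum_eq_zero fun i _ => (h i).1 k hk
  · rw [coeff_sum, LinearMap.sum_apply]
    exact Finset.sum_congr rfl fun i _ => (h i).2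

theorem Creates.neg {vac x : V} {a : VertexOperator K V} (h : Creates vac a x) :
    Creates vac (-a) (-x) := by
  refine ⟨fun k hk => ?_, ?_⟩
  · rw [coeff_neg, LinearMap.neg_apply, h.1 k hk, neg_zero]
  · rw [coeff_neg, LinearMap.neg_apply, h.2]

theorem Creates.sub {vac x y : V} {a b : VertexOperator K V} (h : Creates vac a x)
    (h' : Creates vac b y) : Creates vac (a - b) (x - y) := by
  rw [sub_eq_add_neg]
  refine ⟨fun k hk => ?_, ?_⟩
  · rw [coeff_add, coeff_neg, LinearMap.add_apply, LinearMap.neg_apply, h.1 k hk, h'.1 k hk,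
      neg_zero, add_zero]
  · rw [coeff_add, coeff_neg, LinearMap.add_apply, LinearMap.neg_apply, h.2, h'.2, sub_eq_add_neg]

/-! ### Fermion numbers -/

section FermionNumber

variable {deg : ℤ → Submodule K V} {d d' : ℤ} {a b : VertexOperator K V}

theorem HasFermionNumber.normalOrder (s : ℤˣ) (ha : HasFermionNumber deg a d)
    (hb : HasFermionNumber deg b d') : HasFermionNumber deg (normalOrder s a b) (d + d') := by
  intro k j v hv
  refine locSum_mem (normalOrderTerm_finite _ _ _ k) fun i => ?_
  rw [normalOrderTerm]
  split_ifs
  · rw [Module.End.mul_apply, add_comm d, ← add_assoc]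
    exact ha _ _ _ (hb _ _ _ hv)
  · rw [Units.smul_def, LinearMap.smul_apply, Module.End.mul_apply, ← add_assoc]
    exact zsmul_mem (hb _ _ _ (ha _ _ _ hv)) _

theorem HasFermionNumber.derivField (ha : HasFermionNumber deg a d) :
    HasFermionNumber deg (derivField a) d := fun _ _ _ hv =>
  zsmul_mem (ha _ _ _ hv) _

theorem HasFermionNumber.sum {ι : Type*} {t : Finset ι} {a : ι → VertexOperator K V}
    (h : ∀ i, HasFermionNumber deg (a i) d) : HasFermionNumber deg (∑ i ∈ t, a i) d := by
  intro k j v hv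
  rw [coeff_sum, LinearMap.sum_apply]
  exact sum_mem fun i _ => h i k j v hv

theorem HasFermionNumber.neg (h : HasFermionNumber deg a d) : HasFermionNumber deg (-a) d := by
  intro k j v hv
  rw [coeff_neg, LinearMap.neg_apply]
  exact neg_mem (h k j v hv)

end FermionNumber

/-! ### Supercommutators and weights -/

theorem superBracketField_sum {ι : Type*} (t : Finset ι) (p q : ℤ) (A : End K V)
    (a : ι → VertexOperator K V) :
    superBracketField p q A (∑ i ∈ t, a i) = ∑ i ∈ t, superBracketField p q A (a i) := by
  refine field_ext fun k => ?_
  simp only [coeff_superBracketField, coeff_sum, superBracket, Finset.mul_sum, Finset.sum_mul,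
    Finset.smul_sum, Finset.sum_sub_distrib]

theorem superBracketField_neg (p q : ℤ) (A : End K V) (a : VertexOperator K V) :
    superBracketField p q A (-a) = -superBracketField p q A a := by
  refine field_ext fun k => ?_
  simp only [coeff_superBracketField, coeff_neg, superBracket, mul_neg, neg_mul, smul_neg]
  abel

theorem IsPrimary.neg {vac : V} {L a : VertexOperator K V} {w : ℤ} (h : IsPrimary vac L a w) :
    IsPrimary vac L (-a) w := by
  obtain ⟨x, hx, h0, hpos⟩ := h
  refine ⟨-x, hx.neg, ?_, fun n hn => ?_⟩
  · rw [map_neg, h0, smul_neg]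
  · rw [map_neg, hpos n hn, neg_zero]

end FieldCalculus

/-- Modes `β`, `γ`, `b`, `c` on a graded space with a vacuum, subject to the relations of the
vertex operator Weil algebra. -/
structure ModeSystem (K ℓ V : Type*) [CommRing K] [AddCommGroup ℓ] [Module K ℓ] [AddCommGroup V]
    [Module K V] where
  beta : ℤ → ℓ →ₗ[K] End K V
  gamma : ℤ → Dual K ℓ →ₗ[K] End K V
  b : ℤ → ℓ →ₗ[K] End K V
  c : ℤ → Dual K ℓ →ₗ[K] End K V
  vac : V
  deg : ℤ → Submodule K V
  gamma_mul_beta (ξ : Dual K ℓ) (x : ℓ) (n m : ℤ) :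
    gamma n ξ * beta m x = beta m x * gamma n ξ + (if n + m = 0 then ξ x else 0) • 1
  c_mul_b (ξ : Dual K ℓ) (x : ℓ) (n m : ℤ) :
    c n ξ * b m x = -(b m x * c n ξ) + (if n + m = 0 then ξ x else 0) • 1
  beta_beta (x y : ℓ) (n m : ℤ) : Commute (beta n x) (beta m y)
  gamma_gamma (ξ η : Dual K ℓ) (n m : ℤ) : Commute (gamma n ξ) (gamma m η)
  b_mul_b (x y : ℓ) (n m : ℤ) : b n x * b m y = -(b m y * b n x)
  c_mul_c (ξ η : Dual K ℓ) (n m : ℤ) : c n ξ * c m η = -(c m η * c n ξ)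
  beta_b (x y : ℓ) (n m : ℤ) : Commute (beta n x) (b m y)
  beta_c (x : ℓ) (ξ : Dual K ℓ) (n m : ℤ) : Commute (beta n x) (c m ξ)
  gamma_b (ξ : Dual K ℓ) (x : ℓ) (n m : ℤ) : Commute (gamma n ξ) (b m x)
  gamma_c (ξ η : Dual K ℓ) (n m : ℤ) : Commute (gamma n ξ) (c m η)
  beta_vac (x : ℓ) (n : ℤ) (hn : 0 ≤ n) : beta n x vac = 0
  gamma_vac (ξ : Dual K ℓ) (n : ℤ) (hn : 1 ≤ n) : gamma n ξ vac = 0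
  b_vac (x : ℓ) (n : ℤ) (hn : 0 ≤ n) : b n x vac = 0
  c_vac (ξ : Dual K ℓ) (n : ℤ) (hn : 1 ≤ n) : c n ξ vac = 0
  left_zero (v : V) : ∃ N : ℤ, ∀ n ≥ N, ∀ x, beta n x v = 0 ∧ b n x v = 0
  right_zero (v : V) : ∃ N : ℤ, ∀ n ≥ N, ∀ ξ, gamma n ξ v = 0 ∧ c n ξ v = 0
  beta_deg (x : ℓ) (n : ℤ) (hn : n ≤ -1) (j : ℤ) : ∀ v ∈ deg j, beta n x v ∈ deg j
  gamma_deg (ξ : Dual K ℓ) (n : ℤ) (hn : n ≤ 0) (j : ℤ) : ∀ v ∈ deg j, gamma n ξ v ∈ deg j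
  b_deg (x : ℓ) (n : ℤ) (hn : n ≤ -1) (j : ℤ) : ∀ v ∈ deg j, b n x v ∈ deg (j - 1)
  c_deg (ξ : Dual K ℓ) (n : ℤ) (hn : n ≤ 0) (j : ℤ) : ∀ v ∈ deg j, c n ξ v ∈ deg (j + 1)
  /-- The grading is the least one that is compatible with the creation operators. -/
  deg_le (P : ℤ → Submodule K V) (hvac : vac ∈ P 0)
    (hbeta : ∀ x, ∀ n ≤ -1, ∀ j, ∀ v ∈ deg j, v ∈ P j → beta n x v ∈ P j)
    (hgamma : ∀ ξ, ∀ n ≤ 0, ∀ j, ∀ v ∈ deg j, v ∈ P j → gamma n ξ v ∈ P j)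
    (hb : ∀ x, ∀ n ≤ -1, ∀ j, ∀ v ∈ deg j, v ∈ P j → b n x v ∈ P (j - 1))
    (hc : ∀ ξ, ∀ n ≤ 0, ∀ j, ∀ v ∈ deg j, v ∈ P j → c n ξ v ∈ P (j + 1)) (j : ℤ) : deg j ≤ P j

/-! ### Contractions of a basis with its dual basis. -/

theorem sum_coord_smul {K ℓ M ι : Type*} [CommRing K] [AddCommGroup ℓ] [Module K ℓ]
    [AddCommGroup M] [Module K M] [Fintype ι] (e : Basis ι K ℓ) (B : ℓ →ₗ[K] M) (x : ℓ) :
    ∑ i, e.coord i x • B (e i) = B x := by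
  simp_rw [← map_smul, ← map_sum, Basis.coord_apply, e.sum_repr]

theorem sum_smul_coord {K ℓ M ι : Type*} [CommRing K] [AddCommGroup ℓ] [Module K ℓ]
    [AddCommGroup M] [Module K M] [Fintype ι] (e : Basis ι K ℓ) (B : Dual K ℓ →ₗ[K] M)
    (ξ : Dual K ℓ) : ∑ i, ξ (e i) • B (e.coord i) = B ξ := by
  simp_rw [← map_smul, ← map_sum, e.sum_dual_apply_smul_coord]

/-- The canonical element of `ℓ ⊗ ℓ'` in terms of the bases obtained from a symmetric
isomorphism. -/
theorem sum_symm_coord {K ℓ M ι : Type*} [CommRing K] [AddCommGroup ℓ] [Module K ℓ]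
    [AddCommGroup M] [Module K M] [Fintype ι] (e : Basis ι K ℓ) (φ : ℓ ≃ₗ[K] Dual K ℓ)
    (hφ : ∀ x y, φ x y = φ y x) (B : ℓ →ₗ[K] Dual K ℓ →ₗ[K] M) :
    ∑ i, B (φ.symm (e.coord i)) (φ (e i)) = ∑ i, B (e i) (e.coord i) := by
  have h : ∀ i, B (φ.symm (e.coord i)) (φ (e i)) =
      ∑ j, φ (e i) (e j) • B (φ.symm (e.coord i)) (e.coord j) := fun i =>
    (sum_smul_coord e (B (φ.symm (e.coord i))) (φ (e i))).symm
  simp_rw [h]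
  rw [Finset.sum_comm]
  refine Finset.sum_congr rfl fun j _ => ?_
  -- By symmetry the coefficients φ(e i)(e j) are those of φ(e j) in the dual basis, so the inner
  -- sum collapses to φ⁻¹(φ(e j)) = e j.
  have := sum_smul_coord e ((B.flip (e.coord j)) ∘ₗ φ.symm.toLinearMap) (φ (e j))
  simpa [hφ (e j)] using this

namespace ModeSystem

variable {K ℓ V : Type*} [CommRing K] [AddCommGroup ℓ] [Module K ℓ] [AddCommGroup V] [Module K V]
  (S : ModeSystem K ℓ V)

theorem beta_mul_gamma (ξ : Dual K ℓ) (x : ℓ) (n m : ℤ) :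
    S.beta m x * S.gamma n ξ =
      S.gamma n ξ * S.beta m x + (-if n + m = 0 then ξ x else 0) • 1 := by
  rw [gamma_mul_beta, neg_smul, add_neg_cancel_right]

theorem b_mul_c (ξ : Dual K ℓ) (x : ℓ) (n m : ℤ) :
    S.b m x * S.c n ξ = -(S.c n ξ * S.b m x) + (if n + m = 0 then ξ x else 0) • 1 := by
  rw [c_mul_b, neg_add, neg_neg, neg_add_cancel_right]

/-! ### The generating fields -/

/-- `β(z) = ∑ βₙ z⁻ⁿ⁻¹`. -/
noncomputable def betaField (x : ℓ) : VertexOperator K V :=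
  mkField (fun k => S.beta (-k - 1) x) fun v => by
    obtain ⟨N, hN⟩ := S.left_zero v
    exact ⟨-N, fun k hk => (hN (-k - 1) (by omega) x).1⟩

/-- `γ(z) = ∑ γₙ z⁻ⁿ`. -/
noncomputable def gammaField (ξ : Dual K ℓ) : VertexOperator K V :=
  mkField (fun k => S.gamma (-k) ξ) fun v => by
    obtain ⟨N, hN⟩ := S.right_zero v
    exact ⟨-N, fun k hk => (hN (-k) (by omega) ξ).1⟩

/-- `b(z) = ∑ bₙ z⁻ⁿ⁻¹`. -/
noncomputable def bField (x : ℓ) : VertexOperator K V :=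
  mkField (fun k => S.b (-k - 1) x) fun v => by
    obtain ⟨N, hN⟩ := S.left_zero v
    exact ⟨-N, fun k hk => (hN (-k - 1) (by omega) x).2⟩

/-- `c(z) = ∑ cₙ z⁻ⁿ`. -/
noncomputable def cField (ξ : Dual K ℓ) : VertexOperator K V :=
  mkField (fun k => S.c (-k) ξ) fun v => by
    obtain ⟨N, hN⟩ := S.right_zero v
    exact ⟨-N, fun k hk => (hN (-k) (by omega) ξ).2⟩

theorem coeff_betaField (x : ℓ) (k : ℤ) : coeff (S.betaField x) k = S.beta (-k - 1) x := rfl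

theorem coeff_gammaField (ξ : Dual K ℓ) (k : ℤ) :
    coeff (S.gammaField ξ) k = S.gamma (-k) ξ := rfl

theorem coeff_bField (x : ℓ) (k : ℤ) : coeff (S.bField x) k = S.b (-k - 1) x := rfl

theorem coeff_cField (ξ : Dual K ℓ) (k : ℤ) : coeff (S.cField ξ) k = S.c (-k) ξ := rfl

theorem coeff_deriv_gammaField (ξ : Dual K ℓ) (k : ℤ) :
    coeff (derivField (S.gammaField ξ)) k = (k + 1) • S.gamma (-(k + 1)) ξ := rfl

theorem coeff_deriv_cField (ξ : Dual K ℓ) (k : ℤ) :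
    coeff (derivField (S.cField ξ)) k = (k + 1) • S.c (-(k + 1)) ξ := rfl

theorem creates_betaField (x : ℓ) : Creates S.vac (S.betaField x) (S.beta (-1) x S.vac) :=
  ⟨fun _ _ => S.beta_vac x _ (by omega), rfl⟩

theorem creates_gammaField (ξ : Dual K ℓ) :
    Creates S.vac (S.gammaField ξ) (S.gamma 0 ξ S.vac) :=
  ⟨fun _ _ => S.gamma_vac ξ _ (by omega), rfl⟩

theorem creates_bField (x : ℓ) : Creates S.vac (S.bField x) (S.b (-1) x S.vac) :=
  ⟨fun _ _ => S.b_vac x _ (by omega), rfl⟩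

theorem creates_cField (ξ : Dual K ℓ) : Creates S.vac (S.cField ξ) (S.c 0 ξ S.vac) :=
  ⟨fun _ _ => S.c_vac ξ _ (by omega), rfl⟩

theorem creates_deriv_gammaField (ξ : Dual K ℓ) :
    Creates S.vac (derivField (S.gammaField ξ)) (S.gamma (-1) ξ S.vac) :=
  (S.creates_gammaField ξ).derivField

theorem creates_deriv_cField (ξ : Dual K ℓ) :
    Creates S.vac (derivField (S.cField ξ)) (S.c (-1) ξ S.vac) :=
  (S.creates_cField ξ).derivField

/-! ### Fermion numbers of the modes -/

/-- For an annihilation mode, move it to the right through a string of creation operators until it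
reaches the vacuum. Passing a γ may leave a multiple of the remaining string itself; this is why the
induction principle `deg_le` also hands over `v ∈ deg j`. The three companions below work in the
same way. -/
theorem beta_mem_deg (x : ℓ) (n j : ℤ) (v : V) (hv : v ∈ S.deg j) : S.beta n x v ∈ S.deg j := by
  rcases le_or_gt n (-1) with hn | hn
  · exact S.beta_deg x n hn j v hv
  refine S.deg_le (fun j => (S.deg j).comap (S.beta n x)) ?_ ?_ ?_ ?_ ?_ j hv
  · simp [S.beta_vac x n (by omega)]
  · intro y m hm j v _ h
    have := LinearMap.congr_fun (S.beta_beta x y n m).eq v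
    simp only [Submodule.mem_comap, Module.End.mul_apply] at this h ⊢
    exact this ▸ S.beta_deg y m hm j _ h
  · intro ξ m hm j v hv h
    have := LinearMap.congr_fun (S.beta_mul_gamma ξ x m n) v
    simp only [Submodule.mem_comap, Module.End.mul_apply, LinearMap.add_apply,
      LinearMap.smul_apply, Module.End.one_apply] at this h ⊢
    exact this ▸ add_mem (S.gamma_deg ξ m hm j _ h) (Submodule.smul_mem _ _ hv)
  · intro y m hm j v _ h
    have := LinearMap.congr_fun (S.beta_b x y n m).eq v
    simp only [Submodule.mem_comap, Module.End.mul_apply] at this h ⊢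
    exact this ▸ S.b_deg y m hm j _ h
  · intro ξ m hm j v _ h
    have := LinearMap.congr_fun (S.beta_c x ξ n m).eq v
    simp only [Submodule.mem_comap, Module.End.mul_apply] at this h ⊢
    exact this ▸ S.c_deg ξ m hm j _ h

theorem gamma_mem_deg (ξ : Dual K ℓ) (n j : ℤ) (v : V) (hv : v ∈ S.deg j) :
    S.gamma n ξ v ∈ S.deg j := by
  rcases le_or_gt n 0 with hn | hn
  · exact S.gamma_deg ξ n hn j v hv
  refine S.deg_le (fun j => (S.deg j).comap (S.gamma n ξ)) ?_ ?_ ?_ ?_ ?_ j hv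
  · simp [S.gamma_vac ξ n (by omega)]
  · intro x m hm j v hv h
    have := LinearMap.congr_fun (S.gamma_mul_beta ξ x n m) v
    simp only [Submodule.mem_comap, Module.End.mul_apply, LinearMap.add_apply,
      LinearMap.smul_apply, Module.End.one_apply] at this h ⊢
    exact this ▸ add_mem (S.beta_deg x m hm j _ h) (Submodule.smul_mem _ _ hv)
  · intro η m hm j v _ h
    have := LinearMap.congr_fun (S.gamma_gamma ξ η n m).eq v
    simp only [Submodule.mem_comap, Module.End.mul_apply] at this h ⊢
    exact this ▸ S.gamma_deg η m hm j _ h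
  · intro y m hm j v _ h
    have := LinearMap.congr_fun (S.gamma_b ξ y n m).eq v
    simp only [Submodule.mem_comap, Module.End.mul_apply] at this h ⊢
    exact this ▸ S.b_deg y m hm j _ h
  · intro η m hm j v _ h
    have := LinearMap.congr_fun (S.gamma_c ξ η n m).eq v
    simp only [Submodule.mem_comap, Module.End.mul_apply] at this h ⊢
    exact this ▸ S.c_deg η m hm j _ h

theorem b_mem_deg (x : ℓ) (n j : ℤ) (v : V) (hv : v ∈ S.deg j) : S.b n x v ∈ S.deg (j - 1) := by
  rcases le_or_gt n (-1) with hn | hn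
  · exact S.b_deg x n hn j v hv
  refine S.deg_le (fun j => (S.deg (j - 1)).comap (S.b n x)) ?_ ?_ ?_ ?_ ?_ j hv
  · simp [S.b_vac x n (by omega)]
  · intro y m hm j v _ h
    have := LinearMap.congr_fun (S.beta_b y x m n).eq v
    simp only [Submodule.mem_comap, Module.End.mul_apply] at this h ⊢
    exact this ▸ S.beta_deg y m hm _ _ h
  · intro ξ m hm j v _ h
    have := LinearMap.congr_fun (S.gamma_b ξ x m n).eq v
    simp only [Submodule.mem_comap, Module.End.mul_apply] at this h ⊢
    exact this ▸ S.gamma_deg ξ m hm _ _ h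
  · intro y m hm j v _ h
    have := LinearMap.congr_fun (S.b_mul_b x y n m) v
    simp only [Submodule.mem_comap, Module.End.mul_apply, LinearMap.neg_apply] at this h ⊢
    exact this ▸ neg_mem (S.b_deg y m hm _ _ h)
  · intro ξ m hm j v hv h
    have := LinearMap.congr_fun (S.b_mul_c ξ x m n) v
    simp only [Submodule.mem_comap, Module.End.mul_apply, LinearMap.add_apply,
      LinearMap.neg_apply, LinearMap.smul_apply, Module.End.one_apply] at this h ⊢
    -- Creating with c and contracting with b returns to degree j + 1 - 1 = j, the degree of the
    -- contraction term.
    rw [this, add_sub_cancel_right]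
    refine add_mem (neg_mem ?_) (Submodule.smul_mem _ _ hv)
    simpa using S.c_deg ξ m hm _ _ h

theorem c_mem_deg (ξ : Dual K ℓ) (n j : ℤ) (v : V) (hv : v ∈ S.deg j) :
    S.c n ξ v ∈ S.deg (j + 1) := by
  rcases le_or_gt n 0 with hn | hn
  · exact S.c_deg ξ n hn j v hv
  refine S.deg_le (fun j => (S.deg (j + 1)).comap (S.c n ξ)) ?_ ?_ ?_ ?_ ?_ j hv
  · simp [S.c_vac ξ n (by omega)]
  · intro y m hm j v _ h
    have := LinearMap.congr_fun (S.beta_c y ξ m n).eq v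
    simp only [Submodule.mem_comap, Module.End.mul_apply] at this h ⊢
    exact this ▸ S.beta_deg y m hm _ _ h
  · intro η m hm j v _ h
    have := LinearMap.congr_fun (S.gamma_c η ξ m n).eq v
    simp only [Submodule.mem_comap, Module.End.mul_apply] at this h ⊢
    exact this ▸ S.gamma_deg η m hm _ _ h
  · intro x m hm j v hv h
    have := LinearMap.congr_fun (S.c_mul_b ξ x n m) v
    simp only [Submodule.mem_comap, Module.End.mul_apply, LinearMap.add_apply,
      LinearMap.neg_apply, LinearMap.smul_apply, Module.End.one_apply] at this h ⊢
    rw [this, sub_add_cancel]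
    refine add_mem (neg_mem ?_) (Submodule.smul_mem _ _ hv)
    simpa using S.b_deg x m hm _ _ h
  · intro η m hm j v _ h
    have := LinearMap.congr_fun (S.c_mul_c ξ η n m) v
    simp only [Submodule.mem_comap, Module.End.mul_apply, LinearMap.neg_apply] at this h ⊢
    exact this ▸ neg_mem (S.c_deg η m hm _ _ h)

theorem betaField_fermion (x : ℓ) : HasFermionNumber S.deg (S.betaField x) 0 := fun k j v hv => by
  rw [add_zero]
  exact S.beta_mem_deg x _ j v hv

theorem gammaField_fermion (ξ : Dual K ℓ) : HasFermionNumber S.deg (S.gammaField ξ) 0 :=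
  fun k j v hv => by
    rw [add_zero]
    exact S.gamma_mem_deg ξ _ j v hv

theorem bField_fermion (x : ℓ) : HasFermionNumber S.deg (S.bField x) (-1) :=
  fun _ j v hv => S.b_mem_deg x _ j v hv

theorem cField_fermion (ξ : Dual K ℓ) : HasFermionNumber S.deg (S.cField ξ) 1 :=
  fun _ j v hv => S.c_mem_deg ξ _ j v hv

section Operators

variable {ι : Type*} [Fintype ι] (e : Basis ι K ℓ) (φ : ℓ ≃ₗ[K] Dual K ℓ)

/-- For large n the factor bₙ kills `v`; for very negative n the factor γ₋ₙ does, and it may be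
applied first because the two commute. -/
theorem h_finite (v : V) : (Function.support fun n : ℤ =>
    ((1 : K) • ∑ i, S.gamma (-n) (e.coord i) * S.b n (e i)) v).Finite := by
  obtain ⟨N, hN⟩ := S.left_zero v
  obtain ⟨M, hM⟩ := S.right_zero v
  refine (Set.finite_Icc (-M) N).subset fun n hn => ?_
  by_contra h
  apply hn
  simp only [LinearMap.smul_apply, LinearMap.sum_apply]
  rw [Finset.sum_eq_zero, smul_zero]
  intro i _
  by_cases h1 : N ≤ n
  · rw [Module.End.mul_apply, (hN n h1 (e i)).2, map_zero]
  · have h2 : M ≤ -n := by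
      by_contra h2
      exact h ⟨by omega, by omega⟩
    rw [(S.gamma_b _ _ _ _).eq, Module.End.mul_apply, (hM (-n) h2 (e.coord i)).1, map_zero]

theorem r_finite (v : V) : (Function.support fun n : ℤ =>
    ((n : K) • ∑ i, S.gamma (-n) (φ (e i)) * S.c n (e.coord i)) v).Finite := by
  obtain ⟨M, hM⟩ := S.right_zero v
  refine (Set.finite_Icc (-M) M).subset fun n hn => ?_
  by_contra h
  apply hn
  simp only [LinearMap.smul_apply, LinearMap.sum_apply]
  rw [Finset.sum_eq_zero, smul_zero]
  intro i _
  by_cases h1 : M ≤ n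
  · rw [Module.End.mul_apply, (hM n h1 (e.coord i)).2, map_zero]
  · have h2 : M ≤ -n := by
      by_contra h2
      exact h ⟨by omega, by omega⟩
    rw [(S.gamma_c _ _ _ _).eq, Module.End.mul_apply, (hM (-n) h2 (φ (e i))).1, map_zero]

/-- The Koszul differential `h = ∑ γ₋ₙ^{u'} bₙ^u`. -/
noncomputable def hOp : End K V :=
  locSum (fun n => (1 : K) • ∑ i, S.gamma (-n) (e.coord i) * S.b n (e i)) (S.h_finite e)

/-- The operator `r = ∑ n γ₋ₙ^{φ(u)} cₙ^{u'}`. -/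
noncomputable def rOp : End K V :=
  locSum (fun n => (n : K) • ∑ i, S.gamma (-n) (φ (e i)) * S.c n (e.coord i)) (S.r_finite e φ)

/-- `h(z) = ∑ γ^{u'}(z) b^u(z)`. -/
noncomputable def hField : VertexOperator K V :=
  ∑ i, normalOrder 1 (S.gammaField (e.coord i)) (S.bField (e i))

/-- `k(z) = ∑ β^u(z) d/dz c^{u'}(z)`. -/
noncomputable def kField : VertexOperator K V :=
  ∑ i, normalOrder 1 (S.betaField (e i)) (derivField (S.cField (e.coord i)))

/-- `r(z) = ∑ γ^{φ(u)}(z) d/dz c^{u'}(z)`. -/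
noncomputable def rField : VertexOperator K V :=
  ∑ i, normalOrder 1 (S.gammaField (φ (e i))) (derivField (S.cField (e.coord i)))

/-- `t(z) = ∑ β^{φ⁻¹(u')}(z) b^u(z)`. -/
noncomputable def tField : VertexOperator K V :=
  ∑ i, normalOrder 1 (S.betaField (φ.symm (e.coord i))) (S.bField (e i))

/-- The Virasoro field `ω(z) = -∑ :b^u(z) d/dz c^{u'}(z): - ∑ :β^u(z) d/dz γ^{u'}(z):`. -/
noncomputable def omegaField : VertexOperator K V :=
  -(∑ i, normalOrder (-1) (S.bField (e i)) (derivField (S.cField (e.coord i)))) -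
    ∑ i, normalOrder 1 (S.betaField (e i)) (derivField (S.gammaField (e.coord i)))

/-- The fermion number field `F(z) = ∑ :c^{u'}(z) b^u(z):`. -/
noncomputable def fermionField : VertexOperator K V :=
  ∑ i, normalOrder (-1) (S.cField (e.coord i)) (S.bField (e i))

/-- The state of `h(z)`. -/
noncomputable def hState : V := ∑ i, S.gamma 0 (e.coord i) (S.b (-1) (e i) S.vac)

/-- The state of `k(z)`. -/
noncomputable def kState : V := ∑ i, S.beta (-1) (e i) (S.c (-1) (e.coord i) S.vac)

/-- The state of `r(z)`. -/
noncomputable def rState : V := ∑ i, S.gamma 0 (φ (e i)) (S.c (-1) (e.coord i) S.vac)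

/-- The state of `t(z)`. -/
noncomputable def tState : V := ∑ i, S.beta (-1) (φ.symm (e.coord i)) (S.b (-1) (e i) S.vac)

/-- The Virasoro element. -/
noncomputable def omegaState : V :=
  -(∑ i, S.b (-1) (e i) (S.c (-1) (e.coord i) S.vac)) -
    ∑ i, S.beta (-1) (e i) (S.gamma (-1) (e.coord i) S.vac)

/-! ### Fields and states -/

theorem creates_hField : Creates S.vac (S.hField e) (S.hState e) :=
  Creates.sum fun i => (S.creates_gammaField (e.coord i)).normalOrder 1 (S.creates_bField (e i))

theorem creates_kField : Creates S.vac (S.kField e) (S.kState e) :=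
  Creates.sum fun i => (S.creates_betaField (e i)).normalOrder 1
    (S.creates_deriv_cField (e.coord i))

theorem creates_rField : Creates S.vac (S.rField e φ) (S.rState e φ) :=
  Creates.sum fun i => (S.creates_gammaField (φ (e i))).normalOrder 1
    (S.creates_deriv_cField (e.coord i))

theorem creates_tField : Creates S.vac (S.tField e φ) (S.tState e φ) :=
  Creates.sum fun i => (S.creates_betaField (φ.symm (e.coord i))).normalOrder 1
    (S.creates_bField (e i))

theorem creates_omegaField : Creates S.vac (S.omegaField e) (S.omegaState e) :=
  (Creates.sum fun i => (S.creates_bField (e i)).normalOrder (-1)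
    (S.creates_deriv_cField (e.coord i))).neg.sub
    (Creates.sum fun i => (S.creates_betaField (e i)).normalOrder 1
      (S.creates_deriv_gammaField (e.coord i)))

theorem creates_fermionField :
    Creates S.vac (S.fermionField e) (∑ i, S.c 0 (e.coord i) (S.b (-1) (e i) S.vac)) :=
  Creates.sum fun i => (S.creates_cField (e.coord i)).normalOrder (-1) (S.creates_bField (e i))

theorem hField_fermion : HasFermionNumber S.deg (S.hField e) (-1) :=
  HasFermionNumber.sum fun i => (S.gammaField_fermion (e.coord i)).normalOrder 1
    (S.bField_fermion (e i))

theorem kField_fermion : HasFermionNumber S.deg (S.kField e) 1 :=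
  HasFermionNumber.sum fun i => (S.betaField_fermion (e i)).normalOrder 1
    (S.cField_fermion (e.coord i)).derivField

theorem rField_fermion : HasFermionNumber S.deg (S.rField e φ) 1 :=
  HasFermionNumber.sum fun i => (S.gammaField_fermion (φ (e i))).normalOrder 1
    (S.cField_fermion (e.coord i)).derivField

theorem tField_fermion : HasFermionNumber S.deg (S.tField e φ) (-1) :=
  HasFermionNumber.sum fun i => (S.betaField_fermion (φ.symm (e.coord i))).normalOrder 1
    (S.bField_fermion (e i))

theorem fermionField_fermion : HasFermionNumber S.deg (S.fermionField e) 0 :=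
  HasFermionNumber.sum fun i => (S.cField_fermion (e.coord i)).normalOrder (-1)
    (S.bField_fermion (e i))

/-! ### Charges -/

/-- Normal ordering has no effect on commuting factors, so both branches of each term coincide with
γ₋ₙ bₙ. -/
theorem ncoeff_hField : VertexOperator.ncoeff (S.hField e) 0 = S.hOp e := by
  rw [VertexOperator.ncoeff_apply, hField, coeff_sum, hOp]
  refine (locSum_sum (fun i => normalOrderTerm_finite _ _ _ _) _ fun n => ?_).symm
  rw [one_smul]
  refine Finset.sum_congr rfl fun i _ => ?_
  rw [normalOrderTerm, coeff_gammaField, coeff_bField, one_smul,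
    show -(-0 - 1 - n) - 1 = n by ring, (S.gamma_b _ _ _ _).eq, ite_self]

/-- The coefficient γ₋ₙ of zⁿ meets the coefficient of z⁻ⁿ⁻¹ in ∂c(z), which is -n cₙ. This produces
the minus sign. -/
theorem ncoeff_rField : VertexOperator.ncoeff (S.rField e φ) 0 = -S.rOp e φ := by
  have h : locSum (fun n : ℤ => -(n : K) • ∑ i, S.gamma (-n) (φ (e i)) * S.c n (e.coord i))
      (fun v => (S.r_finite e φ v).subset fun n hn h0 => hn (by
        dsimp only at h0 ⊢
        rw [neg_smul, LinearMap.neg_apply, h0, neg_zero])) = -S.rOp e φ := by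
    rw [← neg_one_smul K (S.rOp e φ)]
    exact locSum_smul _ _ _ fun n => by rw [smul_smul, neg_one_mul]
  rw [VertexOperator.ncoeff_apply, rField, coeff_sum, ← h]
  refine (locSum_sum (fun i => normalOrderTerm_finite _ _ _ _) _ fun n => ?_).symm
  rw [Finset.smul_sum]
  refine Finset.sum_congr rfl fun i _ => ?_
  rw [normalOrderTerm, coeff_gammaField, coeff_deriv_cField, one_smul,
    show -(-0 - 1 - n + 1) = n by ring, show -0 - 1 - n + 1 = -n by ring, mul_smul_comm,
    smul_mul_assoc, (S.gamma_c _ _ _ _).eq, ite_self, ← Int.cast_smul_eq_zsmul K, Int.cast_neg]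

/-! ### Supercommutators with the differentials -/

/-- Only the term n = m contracts, leaving the sum over u of u'(x) b_m^u, which is b_m^x. With the
next three lemmas this describes `h` as the odd derivation β ↦ b ↦ 0, c ↦ γ ↦ 0. -/
theorem hOp_beta (x : ℓ) (m : ℤ) : S.hOp e * S.beta m x - S.beta m x * S.hOp e = S.b m x := by
  have := locSum_mul_comm_left (S.h_finite e) (fun i n => if -n + m = 0 then e.coord i x else 0)
    (A := S.beta m x) (fun i n => S.gamma_mul_beta _ _ _ _) (fun i n => (S.beta_b _ _ _ _).symm) m
    fun n hn i => if_neg (by omega)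
  simp only [neg_add_cancel, if_true, one_smul, sum_coord_smul] at this
  simpa only [hOp, one_smul] using this

theorem hOp_c (ξ : Dual K ℓ) (m : ℤ) : S.hOp e * S.c m ξ + S.c m ξ * S.hOp e = S.gamma m ξ := by
  have := locSum_mul_anticomm_right (S.h_finite e) (fun i n => if m + n = 0 then ξ (e i) else 0)
    (A := S.c m ξ) (fun i n => S.gamma_c _ _ _ _) (fun i n => S.b_mul_c _ _ _ _) (-m)
    fun n hn i => if_neg (by omega)
  simp only [add_neg_cancel, if_true, one_smul, neg_neg, sum_smul_coord] at this
  simpa only [hOp, one_smul] using this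

theorem hOp_gamma (ξ : Dual K ℓ) (m : ℤ) :
    S.hOp e * S.gamma m ξ - S.gamma m ξ * S.hOp e = 0 := by
  have := locSum_mul_comm_left (S.h_finite e) (fun i n => 0)
    (A := S.gamma m ξ) (fun i n => by rw [zero_smul, add_zero, (S.gamma_gamma _ _ _ _).eq])
    (fun i n => (S.gamma_b _ _ _ _).symm) 0 fun n hn i => rfl
  simpa only [hOp, zero_smul, Finset.sum_const_zero, smul_zero] using this

theorem hOp_b (x : ℓ) (m : ℤ) : S.hOp e * S.b m x + S.b m x * S.hOp e = 0 := by
  have := locSum_mul_anticomm_right (S.h_finite e) (fun i n => 0)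
    (A := S.b m x) (fun i n => S.gamma_b _ _ _ _)
    (fun i n => by rw [zero_smul, add_zero, S.b_mul_b]) 0 fun n hn i => rfl
  simpa only [hOp, zero_smul, Finset.sum_const_zero, smul_zero] using this

/-- The contraction yields the scalars φ(u)(x); symmetry turns them into the coordinates φ(x)(u) of
φ(x) in the dual basis. The factor m is the coefficient n at the contracting term n = m. -/
theorem rOp_beta (hφ : ∀ x y, φ x y = φ y x) (x : ℓ) (m : ℤ) :
    S.rOp e φ * S.beta m x - S.beta m x * S.rOp e φ = m • S.c m (φ x) := by
  have := locSum_mul_comm_left (S.r_finite e φ) (fun i n => if -n + m = 0 then φ (e i) x else 0)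
    (A := S.beta m x) (fun i n => S.gamma_mul_beta _ _ _ _) (fun i n => (S.beta_c _ _ _ _).symm) m
    fun n hn i => if_neg (by omega)
  simp only [neg_add_cancel, if_true, hφ _ x, sum_smul_coord] at this
  rwa [Int.cast_smul_eq_zsmul] at this

/-- Here cₙ contracts with b_m at n = -m, whence the factor -m. The scalars are coordinates of x, so
no symmetry of `φ` is required. -/
theorem rOp_b (x : ℓ) (m : ℤ) :
    S.rOp e φ * S.b m x + S.b m x * S.rOp e φ = -m • S.gamma m (φ x) := by
  have := locSum_mul_anticomm_right (S.r_finite e φ)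
    (fun i n => if n + m = 0 then e.coord i x else 0)
    (A := S.b m x) (fun i n => S.gamma_b _ _ _ _) (fun i n => S.c_mul_b _ _ _ _) (-m)
    fun n hn i => if_neg (by omega)
  have h2 := sum_coord_smul e (S.gamma m ∘ₗ φ.toLinearMap) x
  simp only [LinearMap.comp_apply, LinearEquiv.coe_coe] at h2
  simp only [neg_add_cancel, if_true, neg_neg, h2] at this
  rwa [Int.cast_smul_eq_zsmul] at this

theorem rOp_gamma (ξ : Dual K ℓ) (m : ℤ) :
    S.rOp e φ * S.gamma m ξ - S.gamma m ξ * S.rOp e φ = 0 := by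
  have := locSum_mul_comm_left (S.r_finite e φ) (fun i n => 0)
    (A := S.gamma m ξ) (fun i n => by rw [zero_smul, add_zero, (S.gamma_gamma _ _ _ _).eq])
    (fun i n => (S.gamma_c _ _ _ _).symm) 0 fun n hn i => rfl
  simpa only [rOp, zero_smul, Finset.sum_const_zero, smul_zero] using this

theorem rOp_c (ξ : Dual K ℓ) (m : ℤ) : S.rOp e φ * S.c m ξ + S.c m ξ * S.rOp e φ = 0 := by
  have := locSum_mul_anticomm_right (S.r_finite e φ) (fun i n => 0)
    (A := S.c m ξ) (fun i n => S.gamma_c _ _ _ _)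
    (fun i n => by rw [zero_smul, add_zero, S.c_mul_c]) 0 fun n hn i => rfl
  simpa only [rOp, zero_smul, Finset.sum_const_zero, smul_zero] using this

/-- Leibniz rule: `h` turns β ∂c into b ∂c plus β ∂γ, the two halves of -ω(z). -/
theorem superBracket_hOp_kField :
    superBracketField (-1) 1 (S.hOp e) (S.kField e) = -S.omegaField e := by
  have h : ∀ i, superBracketField (-1) 1 (S.hOp e)
      (normalOrder 1 (S.betaField (e i)) (derivField (S.cField (e.coord i)))) =
      normalOrder (-1) (S.bField (e i)) (derivField (S.cField (e.coord i))) +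
        normalOrder 1 (S.betaField (e i)) (derivField (S.gammaField (e.coord i))) := fun i =>
    superBracketField_normalOrder (by simp) (fun k => S.hOp_beta e _ _) fun k => by
      rw [coeff_deriv_cField, coeff_deriv_gammaField, ← S.hOp_c e, mul_smul_comm, smul_mul_assoc,
        smul_add]
  simp only [kField, superBracketField_sum, h, Finset.sum_add_distrib, omegaField]
  abel

/-- Needed because `r` acts on the first factor of `t`, producing ∂c to the left of b, while ω(z)
has b to the left of ∂c. -/
theorem normalOrder_deriv_c_b (ξ : Dual K ℓ) (x : ℓ) :
    normalOrder (-1) (derivField (S.cField ξ)) (S.bField x) =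
      -normalOrder (-1) (S.bField x) (derivField (S.cField ξ)) := by
  refine normalOrder_swap_odd (fun i j hi hj => ?_) fun i j hi hj => ?_
  · rw [coeff_deriv_cField, coeff_bField, smul_mul_assoc, mul_smul_comm, S.c_mul_b,
      if_neg (by omega), zero_smul, add_zero, smul_neg]
  · rw [coeff_deriv_cField, coeff_bField, smul_mul_assoc, mul_smul_comm, S.c_mul_b]
    -- Among annihilation halves only i = j = -1, the pair c₀, b₀, could contract; the factor i + 1
    -- from the derivative removes it.
    rcases eq_or_ne i (-1) with rfl | h
    · simp
    · rw [if_neg (by omega), zero_smul, add_zero, smul_neg]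

theorem superBracket_rOp_tField (hφ : ∀ x y, φ x y = φ y x) :
    superBracketField 1 (-1) (S.rOp e φ) (S.tField e φ) = -S.omegaField e := by
  have h : ∀ i, superBracketField 1 (-1) (S.rOp e φ)
      (normalOrder 1 (S.betaField (φ.symm (e.coord i))) (S.bField (e i))) =
      normalOrder (-1) (S.bField (e i)) (derivField (S.cField (e.coord i))) +
        normalOrder 1 (S.betaField (φ.symm (e.coord i)))
          (derivField (S.gammaField (φ (e i)))) := by
    intro i
    rw [superBracketField_normalOrder (by simp)
      (a' := -derivField (S.cField (e.coord i))) (b' := derivField (S.gammaField (φ (e i))))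
      (fun k => ?_) fun k => ?_, normalOrder_neg_left, normalOrder_deriv_c_b, neg_neg]
    · rw [coeff_betaField, S.rOp_beta e φ hφ, LinearEquiv.apply_symm_apply, coeff_neg,
        coeff_deriv_cField, show -k - 1 = -(k + 1) by ring, neg_smul]
    · rw [coeff_bField, S.rOp_b, coeff_deriv_gammaField, show -(-k - 1) = k + 1 by ring,
        show -k - 1 = -(k + 1) by ring]
  have h2 : ∑ i, normalOrder 1 (S.betaField (φ.symm (e.coord i)))
      (derivField (S.gammaField (φ (e i)))) =
      ∑ i, normalOrder 1 (S.betaField (e i)) (derivField (S.gammaField (e.coord i))) := by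
    -- The invariance of the canonical tensor is applied to the bilinear map (x, ξ) ↦ :β^x ∂γ^ξ:.
    let B : ℓ →ₗ[K] VertexOperator K V :=
      { toFun := S.betaField
        map_add' := fun x y => field_ext fun k => by
          simp only [coeff_add, coeff_betaField, map_add]
        map_smul' := fun r x => field_ext fun k => by
          simp only [coeff_smul, coeff_betaField, map_smul, RingHom.id_apply] }
    let C : Dual K ℓ →ₗ[K] VertexOperator K V :=
      { toFun := fun ξ => derivField (S.gammaField ξ)
        map_add' := fun x y => field_ext fun k => by
          simp only [coeff_add, coeff_deriv_gammaField, map_add, smul_add]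
        map_smul' := fun r x => field_ext fun k => by
          simp only [coeff_smul, coeff_deriv_gammaField, map_smul, RingHom.id_apply]
          rw [smul_comm] }
    exact sum_symm_coord e φ hφ ((normalOrderₗ K V 1).compl₁₂ B C)
  simp only [tField, superBracketField_sum, h, Finset.sum_add_distrib, omegaField, h2]
  abel

/-! ### The Virasoro and fermion number modes -/

/-- Separates the fermionic from the bosonic half of ω(z); each mode commutes with one half and
contracts with the other. -/
theorem virMode_omegaField_comm (A : End K V) (n : ℤ) :
    A * virMode (S.omegaField e) n - virMode (S.omegaField e) n * A =
      -(∑ i, (A * coeff (normalOrder (-1) (S.bField (e i))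
          (derivField (S.cField (e.coord i)))) (-n - 2) -
        coeff (normalOrder (-1) (S.bField (e i))
          (derivField (S.cField (e.coord i)))) (-n - 2) * A)) -
      ∑ i, (A * coeff (normalOrder 1 (S.betaField (e i))
          (derivField (S.gammaField (e.coord i)))) (-n - 2) -
        coeff (normalOrder 1 (S.betaField (e i))
          (derivField (S.gammaField (e.coord i)))) (-n - 2) * A) := by
  simp only [virMode, omegaField, coeff_sub, coeff_neg, coeff_sum, mul_sub, sub_mul, mul_neg,
    neg_mul, Finset.mul_sum, Finset.sum_mul, Finset.sum_sub_distrib]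
  abel

theorem virMode_beta (x : ℓ) (n m : ℤ) :
    virMode (S.omegaField e) n * S.beta m x =
      S.beta m x * virMode (S.omegaField e) n - m • S.beta (n + m) x := by
  have h1 : ∀ i, S.beta m x * coeff (normalOrder (-1) (S.bField (e i))
      (derivField (S.cField (e.coord i)))) (-n - 2) - coeff (normalOrder (-1) (S.bField (e i))
      (derivField (S.cField (e.coord i)))) (-n - 2) * S.beta m x = 0 := fun i =>
    sub_eq_zero.mpr (coeff_normalOrder_commute _ (fun _ => (S.beta_b _ _ _ _).symm)
      (commute_coeff_derivField fun _ => (S.beta_c _ _ _ _).symm) _).eq.symm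
  have h2 : ∀ i, S.beta m x * coeff (normalOrder 1 (S.betaField (e i))
      (derivField (S.gammaField (e.coord i)))) (-n - 2) - coeff (normalOrder 1 (S.betaField (e i))
      (derivField (S.gammaField (e.coord i)))) (-n - 2) * S.beta m x =
      -(m • e.coord i x • S.beta (n + m) (e i)) := by
    intro i
    -- β_m contracts only with ∂γ, whose coefficient of zʲ is (j + 1) γ_{-(j+1)}. So j + 1 = m, and
    -- the β coefficient sits at i₀ = -n - 2 - j, which is the mode n + m.
    rw [coeff_normalOrder_comm 1 (p := fun _ => 0)
      (q := fun j => ((j + 1 : ℤ) : K) * if -(j + 1) + m = 0 then e.coord i x else 0)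
      (i₀ := -n - 2 - m + 1)]
    · rw [if_pos (by ring), zero_smul, smul_zero, add_zero, coeff_betaField,
        show -n - 2 - (-n - 2 - m + 1) + 1 = m by ring,
        show -(-n - 2 - m + 1) - 1 = n + m by ring, mul_smul, Int.cast_smul_eq_zsmul]
    · intro j
      rw [zero_smul, add_zero, one_smul, coeff_betaField, (S.beta_beta _ _ _ _).eq]
    · intro j
      rw [coeff_deriv_gammaField, smul_mul_assoc, S.gamma_mul_beta, one_smul, mul_smul_comm,
        smul_add, mul_smul, Int.cast_smul_eq_zsmul]
    · exact fun _ _ => rfl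
    · intro j hj
      rw [if_neg (by omega), mul_zero]
  have := S.virMode_omegaField_comm e (S.beta m x) n
  simp only [h1, h2, Finset.sum_const_zero, Finset.sum_neg_distrib, ← Finset.smul_sum,
    sum_coord_smul] at this
  rw [sub_eq_iff_eq_add.mp this]
  abel

theorem virMode_gamma (ξ : Dual K ℓ) (n m : ℤ) :
    virMode (S.omegaField e) n * S.gamma m ξ =
      S.gamma m ξ * virMode (S.omegaField e) n - (n + m) • S.gamma (n + m) ξ := by
  have h1 : ∀ i, S.gamma m ξ * coeff (normalOrder (-1) (S.bField (e i))
      (derivField (S.cField (e.coord i)))) (-n - 2) - coeff (normalOrder (-1) (S.bField (e i))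
      (derivField (S.cField (e.coord i)))) (-n - 2) * S.gamma m ξ = 0 := fun i =>
    sub_eq_zero.mpr (coeff_normalOrder_commute _ (fun _ => (S.gamma_b _ _ _ _).symm)
      (commute_coeff_derivField fun _ => (S.gamma_c _ _ _ _).symm) _).eq.symm
  have h2 : ∀ i, S.gamma m ξ * coeff (normalOrder 1 (S.betaField (e i))
      (derivField (S.gammaField (e.coord i)))) (-n - 2) - coeff (normalOrder 1 (S.betaField (e i))
      (derivField (S.gammaField (e.coord i)))) (-n - 2) * S.gamma m ξ =
      -((n + m) • ξ (e i) • S.gamma (n + m) (e.coord i)) := by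
    intro i
    -- γ_m contracts with the coefficient β_{-j-1}, so j = m - 1. What remains is the coefficient of
    -- z^{-(n+m)-1} in ∂γ, with derivative factor -(n + m).
    rw [coeff_normalOrder_comm 1 (q := fun _ => 0)
      (p := fun j => -if m + (-j - 1) = 0 then ξ (e i) else 0) (i₀ := m - 1)]
    · rw [if_pos (by ring), zero_smul, zero_add, one_smul, coeff_deriv_gammaField,
        show -n - 2 - (m - 1) + 1 = -(n + m) by ring, neg_neg, neg_smul, neg_smul, smul_neg,
        neg_neg, smul_comm]
    · intro j
      rw [coeff_betaField, S.beta_mul_gamma, one_smul]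
    · intro j
      rw [coeff_deriv_gammaField, smul_mul_assoc, (S.gamma_gamma _ _ _ _).eq, one_smul,
        mul_smul_comm, zero_smul, add_zero]
    · intro j hj
      rw [if_neg (by omega), neg_zero]
    · exact fun _ _ => rfl
  have := S.virMode_omegaField_comm e (S.gamma m ξ) n
  simp only [h1, h2, Finset.sum_const_zero, Finset.sum_neg_distrib, ← Finset.smul_sum,
    sum_smul_coord] at this
  rw [sub_eq_iff_eq_add.mp this]
  abel

theorem virMode_b (x : ℓ) (n m : ℤ) :
    virMode (S.omegaField e) n * S.b m x =
      S.b m x * virMode (S.omegaField e) n - m • S.b (n + m) x := by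
  have h1 : ∀ i, S.b m x * coeff (normalOrder 1 (S.betaField (e i))
      (derivField (S.gammaField (e.coord i)))) (-n - 2) - coeff (normalOrder 1 (S.betaField (e i))
      (derivField (S.gammaField (e.coord i)))) (-n - 2) * S.b m x = 0 := fun i =>
    sub_eq_zero.mpr (coeff_normalOrder_commute _ (fun _ => S.beta_b _ _ _ _)
      (commute_coeff_derivField fun _ => S.gamma_b _ _ _ _) _).eq.symm
  have h2 : ∀ i, S.b m x * coeff (normalOrder (-1) (S.bField (e i))
      (derivField (S.cField (e.coord i)))) (-n - 2) - coeff (normalOrder (-1) (S.bField (e i))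
      (derivField (S.cField (e.coord i)))) (-n - 2) * S.b m x =
      -(m • e.coord i x • S.b (n + m) (e i)) := by
    intro i
    rw [coeff_normalOrder_comm (-1) (p := fun _ => 0)
      (q := fun j => ((j + 1 : ℤ) : K) * if -(j + 1) + m = 0 then e.coord i x else 0)
      (i₀ := -n - 2 - m + 1)]
    · rw [if_pos (by ring), zero_smul, smul_zero, add_zero, coeff_bField,
        show -n - 2 - (-n - 2 - m + 1) + 1 = m by ring,
        show -(-n - 2 - m + 1) - 1 = n + m by ring, mul_smul, Int.cast_smul_eq_zsmul]
    · intro j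
      rw [zero_smul, add_zero, Units.neg_smul, one_smul, coeff_bField, S.b_mul_b]
    · intro j
      rw [coeff_deriv_cField, smul_mul_assoc, S.c_mul_b, Units.neg_smul, one_smul, mul_smul_comm,
        smul_add, smul_neg, mul_smul, Int.cast_smul_eq_zsmul]
    · exact fun _ _ => rfl
    · intro j hj
      rw [if_neg (by omega), mul_zero]
  have := S.virMode_omegaField_comm e (S.b m x) n
  simp only [h1, h2, Finset.sum_const_zero, Finset.sum_neg_distrib, ← Finset.smul_sum,
    sum_coord_smul] at this
  rw [sub_eq_iff_eq_add.mp this]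
  abel

theorem virMode_c (ξ : Dual K ℓ) (n m : ℤ) :
    virMode (S.omegaField e) n * S.c m ξ =
      S.c m ξ * virMode (S.omegaField e) n - (n + m) • S.c (n + m) ξ := by
  have h1 : ∀ i, S.c m ξ * coeff (normalOrder 1 (S.betaField (e i))
      (derivField (S.gammaField (e.coord i)))) (-n - 2) - coeff (normalOrder 1 (S.betaField (e i))
      (derivField (S.gammaField (e.coord i)))) (-n - 2) * S.c m ξ = 0 := fun i =>
    sub_eq_zero.mpr (coeff_normalOrder_commute _ (fun _ => S.beta_c _ _ _ _)
      (commute_coeff_derivField fun _ => S.gamma_c _ _ _ _) _).eq.symm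
  have h2 : ∀ i, S.c m ξ * coeff (normalOrder (-1) (S.bField (e i))
      (derivField (S.cField (e.coord i)))) (-n - 2) - coeff (normalOrder (-1) (S.bField (e i))
      (derivField (S.cField (e.coord i)))) (-n - 2) * S.c m ξ =
      -((n + m) • ξ (e i) • S.c (n + m) (e.coord i)) := by
    intro i
    rw [coeff_normalOrder_comm (-1) (q := fun _ => 0)
      (p := fun j => if m + (-j - 1) = 0 then ξ (e i) else 0) (i₀ := m - 1)]
    · rw [if_pos (by ring), zero_smul, zero_add, Units.neg_smul, one_smul, coeff_deriv_cField,
        show -n - 2 - (m - 1) + 1 = -(n + m) by ring, neg_neg, neg_smul, smul_neg, neg_neg,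
        smul_comm]
    · intro j
      rw [coeff_bField, S.b_mul_c, Units.neg_smul, one_smul]
    · intro j
      rw [coeff_deriv_cField, smul_mul_assoc, S.c_mul_c, Units.neg_smul, one_smul,
        mul_smul_comm, zero_smul, add_zero, smul_neg]
    · intro j hj
      rw [if_neg (by omega)]
    · exact fun _ _ => rfl
  have := S.virMode_omegaField_comm e (S.c m ξ) n
  simp only [h1, h2, Finset.sum_const_zero, Finset.sum_neg_distrib, ← Finset.smul_sum,
    sum_smul_coord] at this
  rw [sub_eq_iff_eq_add.mp this]
  abel

/-- For n ≥ -1 the mode is the coefficient of a negative power of z in a field that is regular on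
the vacuum. -/
theorem virMode_vac {n : ℤ} (hn : -1 ≤ n) : virMode (S.omegaField e) n S.vac = 0 :=
  (S.creates_omegaField e).1 _ (by omega)

end Operators

end ModeSystem

/-! ### Action of an operator on states built from two modes. -/

section PairStates

variable {K V : Type*} [CommRing K] [AddCommGroup V] [Module K V] {L X Y : End K V} {vac : V}

theorem weight_pair {p q : ℤ} (hL : L vac = 0) (hX : L * X = X * L + p • X)
    (hY : L * Y = Y * L + q • Y) : L (X (Y vac)) = (p + q) • X (Y vac) := by
  have h1 := LinearMap.congr_fun hX (Y vac)
  have h2 := LinearMap.congr_fun hY vac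
  simp only [Module.End.mul_apply, LinearMap.add_apply, LinearMap.smul_apply, hL, map_zero,
    zero_add] at h1 h2
  rw [h1, h2, map_zsmul, add_smul, add_comm]

/-- Moving `L` to the vacuum leaves X' Y and X Y' on it; the second dies at once, the first because
X' passes `Y` without contraction. -/
theorem annihilates_pair {X' Y' : End K V} (hL : L vac = 0) (hX : L * X = X * L - X')
    (hY : L * Y = Y * L - Y') (hc : Commute X' Y) (hX' : X' vac = 0) (hY' : Y' vac = 0) :
    L (X (Y vac)) = 0 := by
  have h1 := LinearMap.congr_fun hX (Y vac)
  have h2 := LinearMap.congr_fun hY vac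
  have h3 := LinearMap.congr_fun hc.eq vac
  simp only [Module.End.mul_apply, LinearMap.sub_apply, hL, hX', hY', map_zero, sub_zero]
    at h1 h2 h3
  rw [h1, h2, h3, map_zero, sub_zero]

end PairStates

namespace ModeSystem

/-! ### Weights, primary states and the fermion number charge. -/

section Weights

variable {K ℓ V : Type*} [CommRing K] [AddCommGroup ℓ] [Module K ℓ] [AddCommGroup V] [Module K V]
  (S : ModeSystem K ℓ V) {ι : Type*} [Fintype ι] (e : Basis ι K ℓ) (φ : ℓ ≃ₗ[K] Dual K ℓ)

theorem virMode_zero_beta (x : ℓ) : virMode (S.omegaField e) 0 * S.beta (-1) x =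
    S.beta (-1) x * virMode (S.omegaField e) 0 + (1 : ℤ) • S.beta (-1) x := by
  rw [virMode_beta, neg_smul, sub_neg_eq_add, zero_add]

theorem virMode_zero_b (x : ℓ) : virMode (S.omegaField e) 0 * S.b (-1) x =
    S.b (-1) x * virMode (S.omegaField e) 0 + (1 : ℤ) • S.b (-1) x := by
  rw [virMode_b, neg_smul, sub_neg_eq_add, zero_add]

theorem virMode_zero_gamma (ξ : Dual K ℓ) : virMode (S.omegaField e) 0 * S.gamma 0 ξ =
    S.gamma 0 ξ * virMode (S.omegaField e) 0 + (0 : ℤ) • S.gamma 0 ξ := by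
  rw [virMode_gamma, zero_add, zero_smul, sub_zero, add_zero]

theorem virMode_zero_c_zero (ξ : Dual K ℓ) : virMode (S.omegaField e) 0 * S.c 0 ξ =
    S.c 0 ξ * virMode (S.omegaField e) 0 + (0 : ℤ) • S.c 0 ξ := by
  rw [virMode_c, zero_add, zero_smul, sub_zero, add_zero]

theorem virMode_zero_c (ξ : Dual K ℓ) : virMode (S.omegaField e) 0 * S.c (-1) ξ =
    S.c (-1) ξ * virMode (S.omegaField e) 0 + (1 : ℤ) • S.c (-1) ξ := by
  rw [virMode_c, zero_add, neg_smul, sub_neg_eq_add]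

theorem smul_c_vac (ξ : Dual K ℓ) {n : ℤ} (hn : 0 < n) :
    ((n + -1) • S.c (n + -1) ξ) S.vac = 0 := by
  rw [LinearMap.smul_apply]
  -- For n = 1 the mode is c₀, a creation operator; the factor n - 1 vanishes instead.
  rcases eq_or_ne n 1 with rfl | h
  · rw [add_neg_cancel, zero_smul]
  · rw [S.c_vac ξ _ (by omega), smul_zero]

theorem smul_gamma_vac (ξ : Dual K ℓ) {n : ℤ} (hn : 0 < n) :
    ((n + 0) • S.gamma (n + 0) ξ) S.vac = 0 := by
  rw [LinearMap.smul_apply, S.gamma_vac ξ _ (by omega), smul_zero]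

theorem smul_b_vac (x : ℓ) {n : ℤ} (hn : 0 < n) :
    ((-1 : ℤ) • S.b (n + -1) x) S.vac = 0 := by
  rw [LinearMap.smul_apply, S.b_vac x _ (by omega), smul_zero]

theorem smul_beta_vac (x : ℓ) {n : ℤ} (hn : 0 < n) :
    ((-1 : ℤ) • S.beta (n + -1) x) S.vac = 0 := by
  rw [LinearMap.smul_apply, S.beta_vac x _ (by omega), smul_zero]

/-- The two modes of the state commute at all indices, so Lₙ with n > 0 finds no contraction. The
same reason serves for `r`, `k` and `t`. -/
theorem hField_primary : IsPrimary S.vac (S.omegaField e) (S.hField e) 1 := by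
  refine ⟨_, S.creates_hField e, ?_, fun n hn => ?_⟩
  · rw [hState, map_sum, Finset.smul_sum]
    exact Finset.sum_congr rfl fun i _ => weight_pair (S.virMode_vac e (by omega))
      (S.virMode_zero_gamma e _) (S.virMode_zero_b e _)
  · rw [hState, map_sum]
    exact Finset.sum_eq_zero fun i _ => annihilates_pair (S.virMode_vac e (by omega))
      (S.virMode_gamma e _ _ _) (S.virMode_b e _ _ _) ((S.gamma_b _ _ _ _).smul_left _)
      (S.smul_gamma_vac _ hn) (S.smul_b_vac _ hn)

theorem rField_primary : IsPrimary S.vac (S.omegaField e) (S.rField e φ) 1 := by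
  refine ⟨_, S.creates_rField e φ, ?_, fun n hn => ?_⟩
  · rw [rState, map_sum, Finset.smul_sum]
    exact Finset.sum_congr rfl fun i _ => weight_pair (S.virMode_vac e (by omega))
      (S.virMode_zero_gamma e _) (S.virMode_zero_c e _)
  · rw [rState, map_sum]
    exact Finset.sum_eq_zero fun i _ => annihilates_pair (S.virMode_vac e (by omega))
      (S.virMode_gamma e _ _ _) (S.virMode_c e _ _ _) ((S.gamma_c _ _ _ _).smul_left _)
      (S.smul_gamma_vac _ hn) (S.smul_c_vac _ hn)

theorem kField_primary : IsPrimary S.vac (S.omegaField e) (S.kField e) 2 := by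
  refine ⟨_, S.creates_kField e, ?_, fun n hn => ?_⟩
  · rw [kState, map_sum, Finset.smul_sum]
    exact Finset.sum_congr rfl fun i _ => weight_pair (S.virMode_vac e (by omega))
      (S.virMode_zero_beta e _) (S.virMode_zero_c e _)
  · rw [kState, map_sum]
    exact Finset.sum_eq_zero fun i _ => annihilates_pair (S.virMode_vac e (by omega))
      (S.virMode_beta e _ _ _) (S.virMode_c e _ _ _) ((S.beta_c _ _ _ _).smul_left _)
      (S.smul_beta_vac _ hn) (S.smul_c_vac _ hn)

theorem tField_primary : IsPrimary S.vac (S.omegaField e) (S.tField e φ) 2 := by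
  refine ⟨_, S.creates_tField e φ, ?_, fun n hn => ?_⟩
  · rw [tState, map_sum, Finset.smul_sum]
    exact Finset.sum_congr rfl fun i _ => weight_pair (S.virMode_vac e (by omega))
      (S.virMode_zero_beta e _) (S.virMode_zero_b e _)
  · rw [tState, map_sum]
    exact Finset.sum_eq_zero fun i _ => annihilates_pair (S.virMode_vac e (by omega))
      (S.virMode_beta e _ _ _) (S.virMode_b e _ _ _) ((S.beta_b _ _ _ _).smul_left _)
      (S.smul_beta_vac _ hn) (S.smul_b_vac _ hn)

/-- Primarity is not to be expected here: L₁ turns c₀ into -c₁, which contracts with b₋₁ and leaves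
minus the number of basis elements times the vacuum. -/
theorem fermionField_weight : HasWeight S.vac (S.omegaField e) (S.fermionField e) 1 := by
  refine ⟨_, S.creates_fermionField e, ?_⟩
  rw [map_sum, Finset.smul_sum]
  exact Finset.sum_congr rfl fun i _ => weight_pair (S.virMode_vac e (by omega))
    (S.virMode_zero_c_zero e _) (S.virMode_zero_b e _)

/-! ### The fermion number operator -/

theorem fermionField_comm (A : End K V) :
    A * VertexOperator.ncoeff (S.fermionField e) 0 -
        VertexOperator.ncoeff (S.fermionField e) 0 * A =
      ∑ i, (A * coeff (normalOrder (-1) (S.cField (e.coord i)) (S.bField (e i))) (-1) -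
        coeff (normalOrder (-1) (S.cField (e.coord i)) (S.bField (e i))) (-1) * A) := by
  rw [VertexOperator.ncoeff_apply, fermionField, coeff_sum, Finset.mul_sum, Finset.sum_mul,
    Finset.sum_sub_distrib]
  rfl

theorem fermionCharge_b (x : ℓ) (m : ℤ) : VertexOperator.ncoeff (S.fermionField e) 0 * S.b m x =
    S.b m x * VertexOperator.ncoeff (S.fermionField e) 0 - S.b m x := by
  have h : ∀ i, S.b m x *
      coeff (normalOrder (-1) (S.cField (e.coord i)) (S.bField (e i))) (-1) -
      coeff (normalOrder (-1) (S.cField (e.coord i)) (S.bField (e i))) (-1) * S.b m x =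
      e.coord i x • S.b m (e i) := by
    intro i
    rw [coeff_normalOrder_comm (-1) (q := fun _ => 0)
      (p := fun j => if -j + m = 0 then e.coord i x else 0) (i₀ := m)]
    · rw [if_pos (by ring), zero_smul, zero_add, Units.neg_smul, one_smul, neg_neg, coeff_bField,
        show -(-1 - m) - 1 = m by ring]
    · intro j
      rw [coeff_cField, S.c_mul_b, Units.neg_smul, one_smul]
    · intro j
      rw [coeff_bField, S.b_mul_b, Units.neg_smul, one_smul, zero_smul, add_zero]
    · intro j hj
      rw [if_neg (by omega)]
    · exact fun _ _ => rfl
  have := S.fermionField_comm e (S.b m x)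
  simp only [h, sum_coord_smul] at this
  rw [sub_eq_iff_eq_add.mp this]
  abel

theorem fermionCharge_c (ξ : Dual K ℓ) (m : ℤ) :
    VertexOperator.ncoeff (S.fermionField e) 0 * S.c m ξ =
      S.c m ξ * VertexOperator.ncoeff (S.fermionField e) 0 + S.c m ξ := by
  have h : ∀ i, S.c m ξ *
      coeff (normalOrder (-1) (S.cField (e.coord i)) (S.bField (e i))) (-1) -
      coeff (normalOrder (-1) (S.cField (e.coord i)) (S.bField (e i))) (-1) * S.c m ξ =
      -(ξ (e i) • S.c m (e.coord i)) := by
    intro i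
    -- `q` is evaluated at the power -1 - i of the second factor b(z). The mode contracting with c_m
    -- is b₋ₘ, at power m - 1, so i₀ = -m.
    rw [coeff_normalOrder_comm (-1) (p := fun _ => 0)
      (q := fun j => if m + (-j - 1) = 0 then ξ (e i) else 0) (i₀ := -m)]
    · rw [if_pos (by ring), zero_smul, smul_zero, add_zero, coeff_cField, neg_neg]
    · intro j
      rw [coeff_cField, S.c_mul_c, Units.neg_smul, one_smul, zero_smul, add_zero]
    · intro j
      rw [coeff_bField, S.b_mul_c, Units.neg_smul, one_smul]
    · exact fun _ _ => rfl
    · intro j hj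
      rw [if_neg (by omega)]
  have := S.fermionField_comm e (S.c m ξ)
  simp only [h, Finset.sum_neg_distrib, sum_smul_coord] at this
  rw [sub_eq_iff_eq_add.mp this]
  abel

theorem fermionCharge_commute_beta (x : ℓ) (m : ℤ) :
    Commute (VertexOperator.ncoeff (S.fermionField e) 0) (S.beta m x) := by
  rw [VertexOperator.ncoeff_apply, fermionField, coeff_sum]
  exact Commute.sum_left _ _ _ fun i _ => coeff_normalOrder_commute _
    (fun _ => (S.beta_c _ _ _ _).symm) (fun _ => (S.beta_b _ _ _ _).symm) _

theorem fermionCharge_commute_gamma (ξ : Dual K ℓ) (m : ℤ) :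
    Commute (VertexOperator.ncoeff (S.fermionField e) 0) (S.gamma m ξ) := by
  rw [VertexOperator.ncoeff_apply, fermionField, coeff_sum]
  exact Commute.sum_left _ _ _ fun i _ => coeff_normalOrder_commute _
    (fun _ => (S.gamma_c _ _ _ _).symm) (fun _ => (S.gamma_b _ _ _ _).symm) _

/-- The eigenspaces of the charge, written as kernels, form a family of submodules compatible with
the creation operators; minimality of the grading puts each degree inside its eigenspace. -/
theorem fermionCharge_apply (j : ℤ) (v : V) (hv : v ∈ S.deg j) :
    VertexOperator.ncoeff (S.fermionField e) 0 v = j • v := by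
  have hmem : ∀ (j : ℤ) (w : V),
      w ∈ LinearMap.ker (VertexOperator.ncoeff (S.fermionField e) 0 - j • (1 : End K V)) ↔
        VertexOperator.ncoeff (S.fermionField e) 0 w = j • w := fun j w => by
    rw [LinearMap.mem_ker, LinearMap.sub_apply, LinearMap.smul_apply, Module.End.one_apply,
      sub_eq_zero]
  refine (hmem j v).mp (S.deg_le
    (fun j => LinearMap.ker (VertexOperator.ncoeff (S.fermionField e) 0 - j • (1 : End K V)))
    ?_ ?_ ?_ ?_ ?_ j hv)
  · rw [hmem, zero_smul]
    exact (S.creates_fermionField e).1 _ (by omega)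
  · intro x m _ j w _ hw
    have := LinearMap.congr_fun (S.fermionCharge_commute_beta e x m).eq w
    rw [hmem] at hw ⊢
    rwa [Module.End.mul_apply, Module.End.mul_apply, hw, map_zsmul] at this
  · intro ξ m _ j w _ hw
    have := LinearMap.congr_fun (S.fermionCharge_commute_gamma e ξ m).eq w
    rw [hmem] at hw ⊢
    rwa [Module.End.mul_apply, Module.End.mul_apply, hw, map_zsmul] at this
  · intro x m _ j w _ hw
    have := LinearMap.congr_fun (S.fermionCharge_b e x m) w
    rw [hmem] at hw ⊢
    rw [sub_smul, one_smul]
    rwa [LinearMap.sub_apply, Module.End.mul_apply, Module.End.mul_apply, hw, map_zsmul] at this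
  · intro ξ m _ j w _ hw
    have := LinearMap.congr_fun (S.fermionCharge_c e ξ m) w
    rw [hmem] at hw ⊢
    rw [add_smul, one_smul]
    rwa [LinearMap.add_apply, Module.End.mul_apply, Module.End.mul_apply, hw, map_zsmul] at this

end Weights

/-! ### Reductions of topological chiral algebra type -/

section Reductions

variable {K ℓ V : Type*} [Field K] [CharZero K] [AddCommGroup ℓ] [Module K ℓ] [AddCommGroup V]
  [Module K V] (S : ModeSystem K ℓ V) {ι : Type*} [Fintype ι] (e : Basis ι K ℓ)
  (φ : ℓ ≃ₗ[K] Dual K ℓ)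

theorem hOp_mul_hOp : S.hOp e * S.hOp e = 0 :=
  locSum_mul_self_eq_zero (S.h_finite e) rfl (fun _ _ => S.hOp_gamma e _ _)
    fun _ _ => S.hOp_b e _ _

theorem rOp_mul_rOp : S.rOp e φ * S.rOp e φ = 0 :=
  locSum_mul_self_eq_zero (S.r_finite e φ) rfl (fun _ _ => S.rOp_gamma e φ _ _)
    fun _ _ => S.rOp_c e φ _ _

theorem isTCAReduction_h : IsTCAReduction S.vac S.deg (-1) (S.omegaField e) (S.fermionField e)
    (S.hField e) (-S.kField e) where
  F_weight := S.fermionField_weight e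
  F_even := S.fermionField_fermion e
  F_charge := S.fermionCharge_apply e
  J_primary := S.hField_primary e
  J_fermion := S.hField_fermion e
  J_charge := by rw [ncoeff_hField, hOp_mul_hOp]
  G_primary := (S.kField_primary e).neg
  G_fermion := (S.kField_fermion e).neg
  bracket := by
    rw [ncoeff_hField, superBracketField_neg, neg_neg, superBracket_hOp_kField, neg_neg]

theorem isTCAReduction_r (hφ : ∀ x y, φ x y = φ y x) :
    IsTCAReduction S.vac S.deg 1 (S.omegaField e) (S.fermionField e)
      (-S.rField e φ) (-S.tField e φ) where
  F_weight := S.fermionField_weight e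
  F_even := S.fermionField_fermion e
  F_charge := S.fermionCharge_apply e
  J_primary := (S.rField_primary e φ).neg
  J_fermion := (S.rField_fermion e φ).neg
  J_charge := by
    rw [map_neg, Pi.neg_apply, ncoeff_rField, neg_neg, rOp_mul_rOp]
  G_primary := (S.tField_primary e φ).neg
  G_fermion := (S.tField_fermion e φ).neg
  bracket := by
    rw [map_neg, Pi.neg_apply, ncoeff_rField, neg_neg, superBracketField_neg,
      S.superBracket_rOp_tField e φ hφ, neg_neg]

end Reductions

end ModeSystem

/-! ### Exactness of the Virasoro element -/

section Exactness

variable {K V : Type*} [CommRing K] [AddCommGroup V] [Module K V] {p q : ℤ} {D : End K V}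
  {G L : VertexOperator K V}

/-- On a closed vector the second half of the anticommutator vanishes, so the bracket becomes D
applied to G v. Both exactness statements come from this. -/
theorem coeff_apply_of_bracket (hpq : (p * q).negOnePow = -1)
    (h : superBracketField p q D G = -L) {v : V} (hv : D v = 0) (k : ℤ) :
    D (coeff G k v) = -coeff L k v := by
  have h1 : superBracket p q D (coeff G k) = -coeff L k := by
    rw [← coeff_superBracketField, h, coeff_neg]
  have := LinearMap.congr_fun h1 v
  simpa [superBracket, hpq, hv] using this

theorem apply_state_of_bracket (hpq : (p * q).negOnePow = -1)
    (h : superBracketField p q D G = -L) {vac g w : V} (hv : D vac = 0) (hG : Creates vac G g)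
    (hL : Creates vac L w) : D g = -w := by
  rw [← hG.2, ← hL.2]
  exact coeff_apply_of_bracket hpq h hv 0

theorem virMode_mem_range (hpq : (p * q).negOnePow = -1) (h : superBracketField p q D G = -L)
    (n : ℤ) (v : V) (hv : v ∈ LinearMap.ker D) : virMode L n v ∈ LinearMap.range D :=
  ⟨-coeff G (-n - 2) v, by rw [map_neg, coeff_apply_of_bracket hpq h hv, neg_neg, virMode]⟩

end Exactness

/-- The consequences of the commutator `[D, G(z)] = -L(z)` for a differential `D` that is, up to
sign, the charge of a field `J(z)`. -/
theorem exactness_of_bracket {K V : Type*} [CommRing K] [AddCommGroup V] [Module K V] {p q : ℤ}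
    {D : End K V} {G L : VertexOperator K V} (hpq : (p * q).negOnePow = -1)
    (h : superBracketField p q D G = -L) (hD : D * D = 0) {vac g w : V} (hv : D vac = 0)
    (hG : Creates vac G g) (hL : Creates vac L w) :
    D g = -w ∧ D w = 0 ∧ w ∈ LinearMap.range D ∧
      ∀ n : ℤ, ∀ v ∈ LinearMap.ker D, virMode L n v ∈ LinearMap.range D := by
  have h1 : D g = -w := apply_state_of_bracket hpq h hv hG hL
  have h2 : D (-g) = w := by rw [map_neg, h1, neg_neg]
  refine ⟨h1, ?_, ⟨_, h2⟩, virMode_mem_range hpq h⟩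
  rw [← h2]
  exact LinearMap.congr_fun hD _

namespace ModeSystem

variable {K ℓ V : Type*} [CommRing K] [AddCommGroup ℓ] [Module K ℓ] [AddCommGroup V]
  [Module K V] (S : ModeSystem K ℓ V) {ι : Type*} [Fintype ι] (e : Basis ι K ℓ)
  (φ : ℓ ≃ₗ[K] Dual K ℓ)

/-- The differential is the z⁻¹ coefficient of a field regular on the vacuum; closedness of the
vacuum lets the bracket be evaluated on states. -/
theorem hOp_vac : S.hOp e S.vac = 0 := by
  rw [← ncoeff_hField]
  exact (S.creates_hField e).1 _ (by omega)

theorem rOp_vac : S.rOp e φ S.vac = 0 := by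
  rw [← neg_neg (S.rOp e φ), ← ncoeff_rField, LinearMap.neg_apply, neg_eq_zero]
  exact (S.creates_rField e φ).1 _ (by omega)

end ModeSystem

/-! ### The two reductions for an abstract mode system. -/

namespace ModeSystem

variable {K ℓ V : Type*} [Field K] [CharZero K] [AddCommGroup ℓ] [Module K ℓ] [AddCommGroup V]
  [Module K V] (S : ModeSystem K ℓ V) {ι : Type*} [Fintype ι] (e : Basis ι K ℓ)
  (φ : ℓ ≃ₗ[K] Dual K ℓ)

/-- The reduction of topological chiral algebra type by the Koszul differential `h`. -/
theorem koszul_reduction :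
    superBracketField (-1) 1 (S.hOp e) (S.kField e) = -S.omegaField e ∧
      S.hOp e (S.kState e) = -S.omegaState e ∧
      S.hOp e * S.hOp e = 0 ∧
      VertexOperator.ncoeff (S.hField e) 0 = S.hOp e ∧
      Creates S.vac (S.hField e) (S.hState e) ∧
      Creates S.vac (S.kField e) (S.kState e) ∧
      Creates S.vac (S.omegaField e) (S.omegaState e) ∧
      IsTCAReduction S.vac S.deg (-1) (S.omegaField e)
        (S.fermionField e) (S.hField e) (-S.kField e) ∧
      S.hOp e (S.omegaState e) = 0 ∧
      S.omegaState e ∈ LinearMap.range (S.hOp e) ∧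
      ∀ n : ℤ, ∀ v ∈ LinearMap.ker (S.hOp e),
        virMode (S.omegaField e) n v ∈ LinearMap.range (S.hOp e) := by
  obtain ⟨h₁, h₂, h₃, h₄⟩ := exactness_of_bracket (by simp) (S.superBracket_hOp_kField e)
    (S.hOp_mul_hOp e) (S.hOp_vac e) (S.creates_kField e) (S.creates_omegaField e)
  exact ⟨S.superBracket_hOp_kField e, h₁, S.hOp_mul_hOp e, S.ncoeff_hField e,
    S.creates_hField e, S.creates_kField e, S.creates_omegaField e, S.isTCAReduction_h e,
    h₂, h₃, h₄⟩

/-- The reduction of topological chiral algebra type by the operator `r` of a symmetric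
isomorphism. -/
theorem killing_reduction (hφ : ∀ x y, φ x y = φ y x) :
    superBracketField 1 (-1) (S.rOp e φ) (S.tField e φ) = -S.omegaField e ∧
      S.rOp e φ (S.tState e φ) = -S.omegaState e ∧
      S.rOp e φ * S.rOp e φ = 0 ∧
      VertexOperator.ncoeff (S.rField e φ) 0 = -S.rOp e φ ∧
      Creates S.vac (S.rField e φ) (S.rState e φ) ∧
      Creates S.vac (S.tField e φ) (S.tState e φ) ∧
      IsTCAReduction S.vac S.deg 1 (S.omegaField e)
        (S.fermionField e) (-S.rField e φ) (-S.tField e φ) ∧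
      S.rOp e φ (S.omegaState e) = 0 ∧
      S.omegaState e ∈ LinearMap.range (S.rOp e φ) ∧
      ∀ n : ℤ, ∀ v ∈ LinearMap.ker (S.rOp e φ),
        virMode (S.omegaField e) n v ∈ LinearMap.range (S.rOp e φ) := by
  obtain ⟨h₁, h₂, h₃, h₄⟩ := exactness_of_bracket (by simp) (S.superBracket_rOp_tField e φ hφ)
    (S.rOp_mul_rOp e φ) (S.rOp_vac e φ) (S.creates_tField e φ) (S.creates_omegaField e)
  exact ⟨S.superBracket_rOp_tField e φ hφ, h₁, S.rOp_mul_rOp e φ, S.ncoeff_rField e φ,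
    S.creates_rField e φ, S.creates_tField e φ, S.isTCAReduction_r e φ hφ, h₂, h₃, h₄⟩

end ModeSystem

/-! ### From relations on vectors to identities of operators. -/

section Endomorphisms

variable {K V : Type*} [CommRing K] [AddCommGroup V] [Module K V] {A B : End K V} {r : K}

theorem mul_eq_mul_add_smul (h : ∀ w, A (B w) = B (A w) + r • w) : A * B = B * A + r • 1 :=
  LinearMap.ext h

theorem commute_of_apply (h : ∀ w, A (B w) = B (A w) + r • w) (hr : r = 0) : Commute A B :=
  LinearMap.ext fun w => (h w).trans (by rw [hr, zero_smul, add_zero, Module.End.mul_apply])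

theorem mul_eq_neg_mul_add_smul (h : ∀ w, A (B w) + B (A w) = r • w) :
    A * B = -(B * A) + r • 1 :=
  LinearMap.ext fun w => eq_neg_add_of_add_eq ((add_comm _ _).trans (h w))

theorem mul_eq_neg_mul (h : ∀ w, A (B w) + B (A w) = r • w) (hr : r = 0) : A * B = -(B * A) := by
  rw [mul_eq_neg_mul_add_smul h, hr, zero_smul, add_zero]

end Endomorphisms

/-! ### The vertex operator Weil algebra as a mode system. -/

section WeilAlgebra

variable (K ℓ : Type*) [CommRing K] [AddCommGroup ℓ] [Module K ℓ]

/-- The relation already holds in the Weyl algebra, which acts on the left factor only; pure tensors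
suffice by additivity. -/
theorem symAct_mul_apply (u v : Gens K ℓ) (w : Space K ℓ) :
    symAct K ℓ u (symAct K ℓ v w) = symAct K ℓ v (symAct K ℓ u w) +
      (pairing K ℓ u.2 v.1 - pairing K ℓ v.2 u.1) • w := by
  induction w using TensorProduct.induction_on with
  | zero => simp only [map_zero, smul_zero, add_zero]
  | tmul s t =>
    change (weylι K ℓ u • weylι K ℓ v • s) ⊗ₜ[K] t = (weylι K ℓ v • weylι K ℓ u • s) ⊗ₜ[K] t +
      (pairing K ℓ u.2 v.1 - pairing K ℓ v.2 u.1) • (s ⊗ₜ[K] t)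
    rw [← mul_smul, weylι_comm, add_smul, mul_smul, algebraMap_smul, TensorProduct.add_tmul,
      TensorProduct.smul_tmul']
  | add w w' h h' =>
    simp only [map_add, smul_add, h, h']
    exact add_add_add_comm _ _ _ _

theorem extAct_mul_apply (u v : Gens K ℓ) (w : Space K ℓ) :
    extAct K ℓ u (extAct K ℓ v w) + extAct K ℓ v (extAct K ℓ u w) =
      (pairing K ℓ u.2 v.1 + pairing K ℓ v.2 u.1) • w := by
  induction w using TensorProduct.induction_on with
  | zero => simp only [map_zero, smul_zero, add_zero]
  | tmul s t =>
    change s ⊗ₜ[K] (cliffι K ℓ u • cliffι K ℓ v • t) + s ⊗ₜ[K] (cliffι K ℓ v • cliffι K ℓ u • t) =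
      (pairing K ℓ u.2 v.1 + pairing K ℓ v.2 u.1) • (s ⊗ₜ[K] t)
    rw [← TensorProduct.tmul_add, ← mul_smul, ← mul_smul, ← add_smul, cliffι_comm,
      neg_add_cancel_comm, algebraMap_smul, TensorProduct.tmul_smul]
  | add w w' h h' =>
    simp only [map_add, smul_add, ← h, ← h']
    exact add_add_add_comm _ _ _ _

theorem symAct_commute_extAct (u g : Gens K ℓ) : Commute (symAct K ℓ u) (extAct K ℓ g) :=
  LinearMap.ext (symAct_extAct_comm K ℓ u g)

/-- The annihilation operators generate the left ideal that is divided out, and the vacuum is the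
class of 1. -/
theorem symAct_vac {u : Gens K ℓ} (hu : u ∈ annihilators K ℓ) : symAct K ℓ u (vac K ℓ) = 0 := by
  have h : (weylι K ℓ u • Submodule.Quotient.mk 1 : SymMod K ℓ) = 0 := by
    rw [← Submodule.Quotient.mk_smul, smul_eq_mul, mul_one, Submodule.Quotient.mk_eq_zero]
    exact Submodule.subset_span ⟨u, hu, rfl⟩
  change (weylι K ℓ u • Submodule.Quotient.mk 1 : SymMod K ℓ) ⊗ₜ[K]
    (Submodule.Quotient.mk 1 : ExtMod K ℓ) = 0
  rw [h, TensorProduct.zero_tmul]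

theorem extAct_vac {u : Gens K ℓ} (hu : u ∈ annihilators K ℓ) : extAct K ℓ u (vac K ℓ) = 0 := by
  have h : (cliffι K ℓ u • Submodule.Quotient.mk 1 : ExtMod K ℓ) = 0 := by
    rw [← Submodule.Quotient.mk_smul, smul_eq_mul, mul_one, Submodule.Quotient.mk_eq_zero]
    exact Submodule.subset_span ⟨u, hu, rfl⟩
  change (Submodule.Quotient.mk 1 : SymMod K ℓ) ⊗ₜ[K]
    (cliffι K ℓ u • Submodule.Quotient.mk 1 : ExtMod K ℓ) = 0
  rw [h, TensorProduct.tmul_zero]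

theorem pairing_single_single (ξ : Dual K ℓ) (x : ℓ) (n m : ℤ) :
    pairing K ℓ (Finsupp.single n ξ) (Finsupp.single m x) = if n + m = 0 then ξ x else 0 := by
  rw [pairing_single_left, Finsupp.single_apply]
  by_cases h : n + m = 0
  · rw [if_pos h, if_pos (by omega)]
  · rw [if_neg h, if_neg (by omega), map_zero]

theorem gammaMode_mul_betaMode (ξ : Dual K ℓ) (x : ℓ) (n m : ℤ) :
    gammaMode ξ n * betaMode x m =
      betaMode x m * gammaMode ξ n + (if n + m = 0 then ξ x else 0) • 1 := by
  rw [← pairing_single_single]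
  refine mul_eq_mul_add_smul fun w => (symAct_mul_apply K ℓ _ _ w).trans ?_
  simp only [map_zero, sub_zero]
  rfl

theorem cMode_mul_bMode (ξ : Dual K ℓ) (x : ℓ) (n m : ℤ) :
    cMode ξ n * bMode x m =
      -(bMode x m * cMode ξ n) + (if n + m = 0 then ξ x else 0) • 1 := by
  rw [← pairing_single_single]
  refine mul_eq_neg_mul_add_smul fun w => (extAct_mul_apply K ℓ _ _ w).trans ?_
  simp only [map_zero, add_zero]

variable {K ℓ} in
theorem map_superdegree {A : End K (Space K ℓ)} {d : ℤ}
    (h : ∀ j v, IsMonomial j v → IsMonomial (j + d) (A v)) (j : ℤ) (v : Space K ℓ)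
    (hv : v ∈ superdegree K ℓ j) : A v ∈ superdegree K ℓ (j + d) :=
  (Submodule.span_le (p := (superdegree K ℓ (j + d)).comap A)).mpr
    (fun w hw => Submodule.subset_span (h j w hw)) hv

variable {K ℓ} in
theorem betaMode_mem_superdegree (x : ℓ) (n : ℤ) (hn : n ≤ -1) (j : ℤ) (v : Space K ℓ)
    (hv : v ∈ superdegree K ℓ j) : betaMode x n v ∈ superdegree K ℓ j := by
  have := map_superdegree (A := betaMode x n) (d := 0)
    (fun j v h => (add_zero j).symm ▸ IsMonomial.beta x n hn h) j v hv
  rwa [add_zero] at this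

variable {K ℓ} in
theorem gammaMode_mem_superdegree (ξ : Dual K ℓ) (n : ℤ) (hn : n ≤ 0) (j : ℤ) (v : Space K ℓ)
    (hv : v ∈ superdegree K ℓ j) : gammaMode ξ n v ∈ superdegree K ℓ j := by
  have := map_superdegree (A := gammaMode ξ n) (d := 0)
    (fun j v h => (add_zero j).symm ▸ IsMonomial.gamma ξ n hn h) j v hv
  rwa [add_zero] at this

/-- Induction on strings of creation operators; passing to spans, it becomes the minimality of the
grading. -/
theorem mem_of_isMonomial (P : ℤ → Submodule K (Space K ℓ)) (hvac : vac K ℓ ∈ P 0)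
    (hbeta : ∀ x, ∀ n ≤ -1, ∀ j, ∀ v ∈ superdegree K ℓ j, v ∈ P j → betaMode x n v ∈ P j)
    (hgamma : ∀ ξ, ∀ n ≤ 0, ∀ j, ∀ v ∈ superdegree K ℓ j, v ∈ P j → gammaMode ξ n v ∈ P j)
    (hb : ∀ x, ∀ n ≤ -1, ∀ j, ∀ v ∈ superdegree K ℓ j, v ∈ P j → bMode x n v ∈ P (j - 1))
    (hc : ∀ ξ, ∀ n ≤ 0, ∀ j, ∀ v ∈ superdegree K ℓ j, v ∈ P j → cMode ξ n v ∈ P (j + 1))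
    {j : ℤ} {v : Space K ℓ} (hv : IsMonomial j v) : v ∈ P j := by
  induction hv with
  | vac => exact hvac
  | beta x n hn hv ih => exact hbeta x n hn _ _ (Submodule.subset_span hv) ih
  | gamma ξ n hn hv ih => exact hgamma ξ n hn _ _ (Submodule.subset_span hv) ih
  | b x n hn hv ih => exact hb x n hn _ _ (Submodule.subset_span hv) ih
  | c ξ n hn hv ih => exact hc ξ n hn _ _ (Submodule.subset_span hv) ih

/-- `betaMode` as a linear map in its argument. -/
noncomputable def betaModeₗ (n : ℤ) : ℓ →ₗ[K] End K (Space K ℓ) where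
  toFun x := betaMode x n
  map_add' := ((symAct K ℓ) ∘ₗ LinearMap.inl K _ _ ∘ₗ Finsupp.lsingle n).map_add
  map_smul' := ((symAct K ℓ) ∘ₗ LinearMap.inl K _ _ ∘ₗ Finsupp.lsingle n).map_smul

/-- `gammaMode` as a linear map in its argument. -/
noncomputable def gammaModeₗ (n : ℤ) : Dual K ℓ →ₗ[K] End K (Space K ℓ) where
  toFun ξ := gammaMode ξ n
  map_add' := ((symAct K ℓ) ∘ₗ LinearMap.inr K _ _ ∘ₗ Finsupp.lsingle n).map_add
  map_smul' := ((symAct K ℓ) ∘ₗ LinearMap.inr K _ _ ∘ₗ Finsupp.lsingle n).map_smul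

/-- `bMode` as a linear map in its argument. -/
noncomputable def bModeₗ (n : ℤ) : ℓ →ₗ[K] End K (Space K ℓ) where
  toFun x := bMode x n
  map_add' := ((extAct K ℓ) ∘ₗ LinearMap.inl K _ _ ∘ₗ Finsupp.lsingle n).map_add
  map_smul' := ((extAct K ℓ) ∘ₗ LinearMap.inl K _ _ ∘ₗ Finsupp.lsingle n).map_smul

/-- `cMode` as a linear map in its argument. -/
noncomputable def cModeₗ (n : ℤ) : Dual K ℓ →ₗ[K] End K (Space K ℓ) where
  toFun ξ := cMode ξ n
  map_add' := ((extAct K ℓ) ∘ₗ LinearMap.inr K _ _ ∘ₗ Finsupp.lsingle n).map_add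
  map_smul' := ((extAct K ℓ) ∘ₗ LinearMap.inr K _ _ ∘ₗ Finsupp.lsingle n).map_smul

/-- The vertex operator Weil algebra with its modes. -/
noncomputable def weilModes : ModeSystem K ℓ (Space K ℓ) where
  beta := betaModeₗ K ℓ
  gamma := gammaModeₗ K ℓ
  b := bModeₗ K ℓ
  c := cModeₗ K ℓ
  vac := vac K ℓ
  deg := superdegree K ℓ
  gamma_mul_beta := gammaMode_mul_betaMode K ℓ
  c_mul_b := cMode_mul_bMode K ℓ
  beta_beta x y n m := commute_of_apply (symAct_mul_apply K ℓ (Finsupp.single n x, 0)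
    (Finsupp.single m y, 0)) (by simp)
  gamma_gamma ξ η n m := commute_of_apply (symAct_mul_apply K ℓ (0, Finsupp.single n ξ)
    (0, Finsupp.single m η)) (by simp)
  b_mul_b x y n m := mul_eq_neg_mul (extAct_mul_apply K ℓ (Finsupp.single n x, 0)
    (Finsupp.single m y, 0)) (by simp)
  c_mul_c ξ η n m := mul_eq_neg_mul (extAct_mul_apply K ℓ (0, Finsupp.single n ξ)
    (0, Finsupp.single m η)) (by simp)
  beta_b x y n m := symAct_commute_extAct K ℓ _ _
  beta_c x ξ n m := symAct_commute_extAct K ℓ _ _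
  gamma_b ξ x n m := symAct_commute_extAct K ℓ _ _
  gamma_c ξ η n m := symAct_commute_extAct K ℓ _ _
  beta_vac x n hn := symAct_vac K ℓ (Or.inl ⟨n, hn, x, rfl⟩)
  gamma_vac ξ n hn := symAct_vac K ℓ (Or.inr ⟨n, hn, ξ, rfl⟩)
  b_vac x n hn := extAct_vac K ℓ (Or.inl ⟨n, hn, x, rfl⟩)
  c_vac ξ n hn := extAct_vac K ℓ (Or.inr ⟨n, hn, ξ, rfl⟩)
  left_zero v := by
    obtain ⟨N, hN⟩ := eventually_zero K ℓ v
    exact ⟨N, fun n hn x => hN n hn _ (Or.inl ⟨x, rfl⟩)⟩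
  right_zero v := by
    obtain ⟨N, hN⟩ := eventually_zero K ℓ v
    exact ⟨N, fun n hn ξ => hN n hn _ (Or.inr ⟨ξ, rfl⟩)⟩
  beta_deg := betaMode_mem_superdegree
  gamma_deg := gammaMode_mem_superdegree
  b_deg x n hn := map_superdegree fun _ _ h => IsMonomial.b x n hn h
  c_deg ξ n hn := map_superdegree fun _ _ h => IsMonomial.c ξ n hn h
  deg_le P hvac hbeta hgamma hb hc _ := Submodule.span_le.mpr fun _ hv =>
    mem_of_isMonomial K ℓ P hvac hbeta hgamma hb hc hv

end WeilAlgebra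

/-! ### The abstract constructions, specialized to `weilModes`, are the concrete ones by definition.
-/

section Comparison

variable {K ℓ : Type*} [CommRing K] [AddCommGroup ℓ] [Module K ℓ]
  {ι : Type*} [Fintype ι] (e : Basis ι K ℓ) (φ : ℓ ≃ₗ[K] Dual K ℓ)

theorem weilModes_vac : (weilModes K ℓ).vac = vac K ℓ := rfl

theorem weilModes_deg : (weilModes K ℓ).deg = superdegree K ℓ := rfl

theorem weilModes_hOp : (weilModes K ℓ).hOp e = hOp e := rfl

theorem weilModes_rOp : (weilModes K ℓ).rOp e φ = rOp e φ := rfl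

theorem weilModes_hField : (weilModes K ℓ).hField e = hField e := rfl

theorem weilModes_kField : (weilModes K ℓ).kField e = kField e := rfl

theorem weilModes_rField : (weilModes K ℓ).rField e φ = rField e φ := rfl

theorem weilModes_tField : (weilModes K ℓ).tField e φ = tField e φ := rfl

theorem weilModes_omegaField : (weilModes K ℓ).omegaField e = omegaField e := rfl

theorem weilModes_fermionField : (weilModes K ℓ).fermionField e = fermionField e := rfl

theorem weilModes_hState : (weilModes K ℓ).hState e = hState e := rfl

theorem weilModes_kState : (weilModes K ℓ).kState e = kState e := rfl

theorem weilModes_rState : (weilModes K ℓ).rState e φ = rState e φ := rfl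

theorem weilModes_tState : (weilModes K ℓ).tState e φ = tState e φ := rfl

theorem weilModes_omegaState : (weilModes K ℓ).omegaState e = omegaState e := rfl

end Comparison

theorem killingIso_symm {K ℓ : Type*} [Field K] [LieRing ℓ] [LieAlgebra K ℓ]
    [FiniteDimensional K ℓ] [LieAlgebra.IsKilling K ℓ] (s : Kˣ) (x y : ℓ) :
    killingIso K ℓ s x y = killingIso K ℓ s y x := by
  change (s : K) • killingForm K ℓ x y = (s : K) • killingForm K ℓ y x
  rw [LieModule.traceForm_comm]

end VOWA

theorem proposition6 {K ℓ : Type*} [Field K] [IsAlgClosed K] [CharZero K]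
    [LieRing ℓ] [LieAlgebra K ℓ] [FiniteDimensional K ℓ]
    {ι : Type*} [Fintype ι] (e : Module.Basis ι K ℓ) :
    (VOWA.superBracketField (-1) 1 (VOWA.hOp e) (VOWA.kField e) = -VOWA.omegaField e ∧
      VOWA.hOp e (VOWA.kState e) = -VOWA.omegaState e ∧
      VOWA.hOp e * VOWA.hOp e = 0 ∧
      VertexOperator.ncoeff (VOWA.hField e) 0 = VOWA.hOp e ∧
      VOWA.Creates (VOWA.vac K ℓ) (VOWA.hField e) (VOWA.hState e) ∧
      VOWA.Creates (VOWA.vac K ℓ) (VOWA.kField e) (VOWA.kState e) ∧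
      VOWA.Creates (VOWA.vac K ℓ) (VOWA.omegaField e) (VOWA.omegaState e) ∧
      VOWA.IsTCAReduction (VOWA.vac K ℓ) (VOWA.superdegree K ℓ) (-1) (VOWA.omegaField e)
        (VOWA.fermionField e) (VOWA.hField e) (-VOWA.kField e) ∧
      VOWA.hOp e (VOWA.omegaState e) = 0 ∧
      VOWA.omegaState e ∈ LinearMap.range (VOWA.hOp e) ∧
      ∀ n : ℤ, ∀ v ∈ LinearMap.ker (VOWA.hOp e),
        VOWA.virMode (VOWA.omegaField e) n v ∈ LinearMap.range (VOWA.hOp e)) ∧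
    ∀ [LieAlgebra.IsSemisimple K ℓ] (s : Kˣ) (φ : ℓ ≃ₗ[K] Module.Dual K ℓ),
      φ = VOWA.killingIso K ℓ s →
      VOWA.superBracketField 1 (-1) (VOWA.rOp e φ) (VOWA.tField e φ) = -VOWA.omegaField e ∧
      VOWA.rOp e φ (VOWA.tState e φ) = -VOWA.omegaState e ∧
      VOWA.rOp e φ * VOWA.rOp e φ = 0 ∧
      VertexOperator.ncoeff (VOWA.rField e φ) 0 = -VOWA.rOp e φ ∧
      VOWA.Creates (VOWA.vac K ℓ) (VOWA.rField e φ) (VOWA.rState e φ) ∧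
      VOWA.Creates (VOWA.vac K ℓ) (VOWA.tField e φ) (VOWA.tState e φ) ∧
      VOWA.IsTCAReduction (VOWA.vac K ℓ) (VOWA.superdegree K ℓ) 1 (VOWA.omegaField e)
        (VOWA.fermionField e) (-VOWA.rField e φ) (-VOWA.tField e φ) ∧
      VOWA.rOp e φ (VOWA.omegaState e) = 0 ∧
      VOWA.omegaState e ∈ LinearMap.range (VOWA.rOp e φ) ∧
      ∀ n : ℤ, ∀ v ∈ LinearMap.ker (VOWA.rOp e φ),
        VOWA.virMode (VOWA.omegaField e) n v ∈ LinearMap.range (VOWA.rOp e φ) := by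
  refine ⟨?_, ?_⟩
  · have h := (VOWA.weilModes K ℓ).koszul_reduction e
    simp only [VOWA.weilModes_vac, VOWA.weilModes_deg, VOWA.weilModes_hOp, VOWA.weilModes_hField,
      VOWA.weilModes_kField, VOWA.weilModes_omegaField, VOWA.weilModes_fermionField,
      VOWA.weilModes_hState, VOWA.weilModes_kState, VOWA.weilModes_omegaState] at h
    exact h
  · intro _ s φ hφ
    -- Semisimplicity supplies the nondegeneracy that makes `φ` an isomorphism; beyond that, only
    -- the symmetry of the Killing form enters, and it survives rescaling by `s`.
    have h := (VOWA.weilModes K ℓ).killing_reduction e φ fun x y => by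
      rw [hφ, VOWA.killingIso_symm]
    simp only [VOWA.weilModes_vac, VOWA.weilModes_deg, VOWA.weilModes_rOp, VOWA.weilModes_rField,
      VOWA.weilModes_tField, VOWA.weilModes_omegaField, VOWA.weilModes_fermionField,
      VOWA.weilModes_rState, VOWA.weilModes_tState, VOWA.weilModes_omegaState] at h
    exact h
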